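/- Online parking (metric matching) on weighted line graphs, pricing with a prior. Let $G$ be a path graph on $m$ vertices (parking slots) with positive edge weights, and let $d(u,v)$ be the weight of a minimum-weight path between $u$ and $v$. Cars $1,\dots,n$ ($n\le m$) arrive online in this order; car $i$ has a private destination $g(i)\in V(G)$ and parks at a slot $x(i)$ that is not occupied by an earlier car. The social cost of the assignment $x$ is $\sum_{i=1}^n d(g(i),x(i))$, and $\mathrm{OPT}(g)$ is its minimum over all injective $x\colon[n]\to V(G)$. A (randomized) dynamic pricing scheme $P=(P_1,\dots,P_n)$ posts, before car $i$ arrives, a real price $P_i(v)$ for every unoccupied slot $v$, as a function of the set of occupied slots and of random bits only; in particular it knows neither the destinations of the cars that have already parked nor those of future cars. An equilibrium, for given random bits, is an assignment in which each car $i$ chooses an unoccupied slot $v$ that minimizes its disutility $d(g(i),v)+P_i(v)$ over the unoccupied slots, with ties broken arbitrarily. **Corollary.** Let $p$ be a real polynomial with $p(n)>0$ for all integers $n\ge 1$. There is a constant $C$, depending only on $p$, such that for all $n\le m$, every path graph $G$ on $m$ vertices with positive edge weights and every real number $Z$, there is a randomized dynamic pricing scheme $P$ (which may depend on $n$, $G$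 and $Z$, but not on $g$) such that for every destination function $g\colon[n]\to V(G)$ with $$\frac{\mathrm{OPT}(g)}{p(n)}\;\le\; Z\;\le\; p(n)\cdot \mathrm{OPT}(g)$$ and every choice $x$ of an equilibrium (as a measurable function of the random bits), $$\mathbb{E}\Big[\sum_{i=1}^n d(g(i),x(i))\Big]\;\le\; C\,\log n\cdot \mathrm{OPT}(g).$$ That is, given an estimate of the cost of the optimal matching to within a $\mathrm{poly}(n)$ factor, there is a payment scheme that gives an $O(\log n)$ approximation to the optimal assignment in weighted line graphs, in expectation. -/

import Mathlib

open MeasureTheory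

/-- Weight of a minimum-weight path from `u` to `v` in the graph `G` with edge weights `w`. -/
noncomputable def graphDist {V : Type*} (G : SimpleGraph V) (w : Sym2 V → ℝ) (u v : V) : ℝ :=
  ⨅ p : G.Path u v, ((p : G.Walk u v).edges.map w).sum

/-- Social cost of the assignment `x` (cars to parking slots) when car `i` has destination `g i`,
for the distance `d`. Parking fees are not part of it. -/
noncomputable def socialCost {V : Type*} {n : ℕ} (d : V → V → ℝ) (g x : Fin n → V) : ℝ :=
  ∑ i, d (g i) (x i)

/-- Cost of an optimal matching: the minimum social cost over all assignments that give different
cars different slots. -/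
noncomputable def optCost {V : Type*} {n : ℕ} (d : V → V → ℝ) (g : Fin n → V) : ℝ :=
  ⨅ x : Fin n ↪ V, socialCost d g x

/-- A randomized dynamic pricing scheme for `n` cars and the set `V` of parking slots. The random
bits are a point `ω` of a probability space. `price i S v ω` is the fee for parking at `v` that is
posted before car `i` arrives, if `S` is the set of slots occupied at that time. In particular the
fees depend neither on the destinations of the cars nor on the future.
(Values at `v ∈ S` are never used.) -/
structure PricingScheme (n : ℕ) (V : Type*) where
  Ω : Type
  [mΩ : MeasurableSpace Ω]
  μ : Measure Ω
  [isProb : IsProbabilityMeasure μ]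
  price : Fin n → Finset V → V → Ω → ℝ
  measurable_price : ∀ i S v, Measurable (price i S v)

attribute [instance] PricingScheme.mΩ PricingScheme.isProb

/-- The slots occupied under the assignment `x` just before car `i` arrives. -/
def occupied {V : Type*} [DecidableEq V] {n : ℕ} (x : Fin n → V) (i : Fin n) : Finset V :=
  (Finset.Iio i).image x

/-- The equilibria of the scheme `P` for the destinations `g`, given the random bits `ω`: each car
in turn parks at an unoccupied slot that minimizes its disutility (distance from its destination
plus the posted fee) among all unoccupied slots, with ties broken arbitrarily. -/
def PricingScheme.equilibria {V : Type*} [DecidableEq V] {n : ℕ} (P : PricingScheme n V)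
    (d : V → V → ℝ) (g : Fin n → V) (ω : P.Ω) : Set (Fin n → V) :=
  {x | ∀ i, x i ∉ occupied x i ∧ ∀ s, s ∉ occupied x i →
    d (g i) (x i) + P.price i (occupied x i) (x i) ω ≤ d (g i) s + P.price i (occupied x i) s ω}

/-! The scheme implements the harmonic algorithm: a car whose nearest free slots on the two sides
are `l` and `r` takes each with probability proportional to its distance from the other one.
Positions are rounded down to multiples of `ε = Z / (p(n) n)`, which changes a matching cost by at
most `nε ≤ OPT`, and edges heavier than `Λ = p(n) Z ≥ OPT` are cut, since an optimal matching never
uses them. At most `n` slots are ever occupied, so a gap between neighbouring free slots of a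
component has at most `n + 1` edges. In units of `ε` its length is at most `Δ = (n + 1) Λ / ε + 1`,
which is polynomial in `n`.

The harmonic algorithm is `O(log Δ)`-competitive by a coupling argument. Take two runs whose free
sets differ in that one lacks `a` and the other lacks the adjacent slot `b`. In each step the
discrepancy can be coupled so as to persist, vanish or grow to a longer gap, without growing in
expectation. The concave potential `δ (1 + 2 log (Δ / δ))` drops enough in expectation to pay for
the differing costs, hence bounds the difference of future costs
(`abs_harmonicCost_sub_le_potential`). Nonzero rounded gaps are at least `1`, so telescoping gives a
Lipschitz bound with constant `K = 1 + 2 log Δ`. Replacing the algorithm's choices by the optimal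
ones car by car gives the ratio `3K + 2` (`harmonicCost_le`).

For a fixed random number the harmonic choice is a monotone function of the destination that fixes
every free slot. Prices with slope `±1` where the choice is constant and `0` where it changes make
that choice the unique best response (`implementingPrice_lt`), so the prices need no knowledge of
destinations and ties never matter. -/

/-! ### The potential function -/

/-- The potential of a discrepancy of size `δ`, if all discrepancies are at most `Δ`. -/
noncomputable def potential (Δ δ : ℝ) : ℝ := δ * (1 + 2 * Real.log (Δ / δ))

theorem potential_zero (Δ : ℝ) : potential Δ 0 = 0 := by simp [potential]

theorem le_potential {Δ δ : ℝ} (hδ : 0 ≤ δ) (h : δ ≤ Δ) : δ ≤ potential Δ δ := by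
  rcases hδ.eq_or_lt with rfl | hδ
  · simp [potential]
  · have : 0 ≤ Real.log (Δ / δ) := Real.log_nonneg (by rwa [le_div_iff₀ hδ, one_mul])
    unfold potential
    nlinarith

/-- This is where rounding pays off: integer positions exclude gaps strictly between `0` and `1`,
for which `log (Δ / δ)` would be unbounded. -/
theorem potential_le {Δ δ : ℝ} (hΔ : 0 < Δ) (hδ : δ = 0 ∨ 1 ≤ δ) :
    potential Δ δ ≤ (1 + 2 * Real.log Δ) * δ := by
  rcases hδ with rfl | hδ
  · simp [potential]
  · have h : Real.log (Δ / δ) ≤ Real.log Δ :=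
      Real.log_le_log (by positivity) (div_le_self hΔ.le hδ)
    unfold potential
    nlinarith

/-- The potential per unit length is `1 + 2 log (Δ / δ)`; it falls by `2 log (δ' / δ) ≥ 2 (1 - δ /
δ')` from `δ` to `δ'`. The form without division also covers `δ = 0`. -/
theorem potential_decrease {Δ δ δ' : ℝ} (hΔ : 0 < Δ) (hδ : 0 ≤ δ) (h : δ ≤ δ') :
    2 * δ * (δ' - δ) ≤ δ' * potential Δ δ - δ * potential Δ δ' := by
  rcases hδ.eq_or_lt with rfl | hδ
  · simp [potential]
  · have hδ' : 0 < δ' := hδ.trans_le h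
    have h1 := Real.one_sub_inv_le_log_of_pos (div_pos hδ' hδ)
    have h2 : Real.log (δ' / δ) = Real.log (Δ / δ) - Real.log (Δ / δ') := by
      rw [Real.log_div hδ'.ne' hδ.ne', Real.log_div hΔ.ne' hδ.ne', Real.log_div hΔ.ne' hδ'.ne']
      ring
    rw [h2, inv_div] at h1
    have h3 : δ * δ' * (1 - δ / δ') = δ * (δ' - δ) := by field_simp
    have h4 := mul_le_mul_of_nonneg_left h1 (mul_pos hδ hδ').le
    unfold potential
    nlinarith

/-- One step of the coupling: with probability `r` the discrepancy `δ` stays, with probabilities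
`p₁` and `p₂` it grows to `δ₁` and `δ₂`, and otherwise it vanishes. -/
theorem potential_step {Δ δ δ₁ δ₂ r p₁ p₂ : ℝ} (hδ : 0 ≤ δ) (hΔ : 0 < Δ) (h : δ ≤ Δ)
    (h₁ : δ ≤ δ₁) (h₂ : δ ≤ δ₂) (hp₁ : 0 ≤ p₁) (hp₂ : 0 ≤ p₂)
    (hm : p₁ * δ₁ + p₂ * δ₂ ≤ (1 - r) * δ) :
    r * potential Δ δ + (1 - r - p₁ - p₂) * δ + p₁ * (δ₁ - δ + potential Δ δ₁)
      + p₂ * (δ₂ - δ + potential Δ δ₂) ≤ potential Δ δ := by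
  -- Of the two copies of `e - δ` gained here, one pays for the extra immediate cost of growing, the
  -- other for the cost `δ` incurred when the discrepancy vanishes.
  have key : ∀ p e : ℝ, 0 ≤ p → δ ≤ e → p * e ≤ (1 - r) * δ → 0 < δ →
      p * potential Δ e * δ ≤ p * e * potential Δ δ - 2 * p * (e - δ) * δ := by
    intro p e hp he _ _
    have := mul_le_mul_of_nonneg_left (potential_decrease hΔ hδ he) hp
    nlinarith
  have hpos : ∀ p e : ℝ, 0 ≤ p → δ ≤ e → 0 ≤ p * e := fun p e hp he =>
    mul_nonneg hp (hδ.trans he)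
  have a₁ := hpos p₁ δ₁ hp₁ h₁
  have a₂ := hpos p₂ δ₂ hp₂ h₂
  rcases hδ.eq_or_lt with h0 | h0
  · subst h0
    have e₁ : p₁ * δ₁ = 0 := by nlinarith
    have e₂ : p₂ * δ₂ = 0 := by nlinarith
    have f : ∀ p e : ℝ, p * e = 0 → p * (e - 0 + potential Δ e) = 0 := by
      intro p e he
      rcases mul_eq_zero.1 he with h | h <;> simp [h, potential_zero]
    rw [f _ _ e₁, f _ _ e₂]
    simp [potential_zero]
  · have k₁ := key p₁ δ₁ hp₁ h₁ (by linarith) h0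
    have k₂ := key p₂ δ₂ hp₂ h₂ (by linarith) h0
    have k₃ := le_potential hδ h
    refine le_of_mul_le_mul_right ?_ h0
    nlinarith [mul_le_mul_of_nonneg_left k₃ (sub_nonneg.2 hm)]

/-! ### The harmonic algorithm -/

section Harmonic

variable {ι : Type*} [LinearOrder ι]

/-- The largest element of a finite set, if there is one. -/
def maxOption (A : Finset ι) : Option ι := if h : A.Nonempty then some (A.max' h) else none

/-- The smallest element of a finite set, if there is one. -/
def minOption (A : Finset ι) : Option ι := if h : A.Nonempty then some (A.min' h) else none

theorem maxOption_eq_none {A : Finset ι} : maxOption A = none ↔ A = ∅ := by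
  simp [maxOption, Finset.not_nonempty_iff_eq_empty]

theorem minOption_eq_none {A : Finset ι} : minOption A = none ↔ A = ∅ := by
  simp [minOption, Finset.not_nonempty_iff_eq_empty]

theorem maxOption_eq_some {A : Finset ι} {l : ι} :
    maxOption A = some l ↔ l ∈ A ∧ ∀ s ∈ A, s ≤ l := by
  unfold maxOption
  split_ifs with h
  · rw [Option.some_inj]
    refine ⟨?_, fun ⟨h1, h2⟩ => le_antisymm (h2 _ (A.max'_mem h)) (A.le_max' _ h1)⟩
    rintro rfl
    exact ⟨A.max'_mem h, fun s hs => A.le_max' s hs⟩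
  · simp only [false_iff, not_and]
    exact fun hl => (h ⟨l, hl⟩).elim

theorem minOption_eq_some {A : Finset ι} {r : ι} :
    minOption A = some r ↔ r ∈ A ∧ ∀ s ∈ A, r ≤ s := by
  unfold minOption
  split_ifs with h
  · rw [Option.some_inj]
    refine ⟨?_, fun ⟨h1, h2⟩ => le_antisymm (A.min'_le _ h1) (h2 _ (A.min'_mem h))⟩
    rintro rfl
    exact ⟨A.min'_mem h, fun s hs => A.min'_le s hs⟩
  · simp only [false_iff, not_and]
    exact fun hl => (h ⟨r, hl⟩).elim

theorem maxOption_erase {A : Finset ι} {b : ι} (h : maxOption A ≠ some b) :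
    maxOption (A.erase b) = maxOption A := by
  rcases hA : maxOption A with _ | l
  · rw [maxOption_eq_none] at hA ⊢; simp [hA]
  · have hne : l ≠ b := fun e => h (by rw [hA, e])
    rw [maxOption_eq_some] at hA ⊢
    exact ⟨Finset.mem_erase.2 ⟨hne, hA.1⟩, fun s hs => hA.2 s (Finset.mem_of_mem_erase hs)⟩

theorem minOption_erase {A : Finset ι} {b : ι} (h : minOption A ≠ some b) :
    minOption (A.erase b) = minOption A := by
  rcases hA : minOption A with _ | l
  · rw [minOption_eq_none] at hA ⊢; simp [hA]
  · have hne : l ≠ b := fun e => h (by rw [hA, e])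
    rw [minOption_eq_some] at hA ⊢
    exact ⟨Finset.mem_erase.2 ⟨hne, hA.1⟩, fun s hs => hA.2 s (Finset.mem_of_mem_erase hs)⟩

/-- The slots of `S` to the left of `g` in the component of `g`. -/
def leftSlots (comp : ι → ℕ) (S : Finset ι) (g : ι) : Finset ι :=
  S.filter fun s => s < g ∧ comp s = comp g

/-- The slots of `S` at or to the right of `g` in the component of `g`. -/
def rightSlots (comp : ι → ℕ) (S : Finset ι) (g : ι) : Finset ι :=
  S.filter fun s => g ≤ s ∧ comp s = comp g

/-- The probability with which a car with destination `g` parks at `l` if it chooses between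
`l` and `r`. -/
noncomputable def leftProb (q : ι → ℕ) (l r g : ι) : ℝ := ((q r : ℝ) - q g) / ((q r : ℝ) - q l)

/-- The expectation of `f` at the slot which a car with destination `g` chooses. -/
noncomputable def stepMean (comp q : ι → ℕ) (S : Finset ι) (g : ι) (f : ι → ℝ) : ℝ :=
  match maxOption (leftSlots comp S g), minOption (rightSlots comp S g) with
  | some l, some r => leftProb q l r g * f l + (1 - leftProb q l r g) * f r
  | some l, none => f l
  | none, some r => f r
  | none, none => 0

/-- The distance of the rounded positions of two slots. -/
def roundDist (q : ι → ℕ) (u v : ι) : ℝ := |(q u : ℝ) - q v|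

/-- The expected cost of the harmonic algorithm, if the slots of `S` are free. -/
noncomputable def harmonicCost (comp q : ι → ℕ) : (n : ℕ) → (Fin n → ι) → Finset ι → ℝ
  | 0, _, _ => 0
  | n + 1, g, S => stepMean comp q S (g 0) fun s =>
      roundDist q (g 0) s + harmonicCost comp q n (Fin.tail g) (S.erase s)

theorem leftSlots_erase (comp : ι → ℕ) (S : Finset ι) (g b : ι) :
    leftSlots comp (S.erase b) g = (leftSlots comp S g).erase b := by
  ext; simp [leftSlots]; tauto

theorem rightSlots_erase (comp : ι → ℕ) (S : Finset ι) (g b : ι) :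
    rightSlots comp (S.erase b) g = (rightSlots comp S g).erase b := by
  ext; simp [rightSlots]; tauto

theorem leftProb_mem {q : ι → ℕ} (hq : Monotone q) {l r g : ι} (hl : l ≤ g) (hr : g ≤ r) :
    0 ≤ leftProb q l r g ∧ leftProb q l r g ≤ 1 := by
  have h1 : (q l : ℝ) ≤ q g := by exact_mod_cast hq hl
  have h2 : (q g : ℝ) ≤ q r := by exact_mod_cast hq hr
  exact ⟨div_nonneg (by linarith) (by linarith), div_le_one_of_le₀ (by linarith) (by linarith)⟩

theorem leftProb_mul {q : ι → ℕ} (hq : Monotone q) {l r g : ι} (hl : l ≤ g) (hr : g ≤ r) :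
    leftProb q l r g * ((q r : ℝ) - q l) = (q r : ℝ) - q g := by
  have h1 : (q l : ℝ) ≤ q g := by exact_mod_cast hq hl
  have h2 : (q g : ℝ) ≤ q r := by exact_mod_cast hq hr
  -- If the rounded positions coincide, division by zero gives probability `0`; the identity
  -- survives because `q g` is squeezed between them.
  rcases eq_or_ne ((q r : ℝ) - q l) 0 with h | h
  · rw [h]; linarith
  · exact div_mul_cancel₀ _ h

theorem stepMean_congr {comp q : ι → ℕ} (hq : Monotone q) {S S' : Finset ι} {g : ι}
    {f f' : ι → ℝ} {B : ℝ} (hB : 0 ≤ B)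
    (hl : maxOption (leftSlots comp S g) = maxOption (leftSlots comp S' g))
    (hr : minOption (rightSlots comp S g) = minOption (rightSlots comp S' g))
    (h : ∀ s ∈ S, s ∈ S' → |f s - f' s| ≤ B) :
    |stepMean comp q S g f - stepMean comp q S' g f'| ≤ B := by
  unfold stepMean
  rw [← hl, ← hr]
  rcases hA : maxOption (leftSlots comp S g) with _ | l <;>
    rcases hA' : minOption (rightSlots comp S g) with _ | r
  · simpa using hB
  · have h1 := (minOption_eq_some.1 hA').1
    have h2 := (minOption_eq_some.1 (hr ▸ hA')).1
    exact h r (Finset.mem_filter.1 h1).1 (Finset.mem_filter.1 h2).1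
  · have h1 := (maxOption_eq_some.1 hA).1
    have h2 := (maxOption_eq_some.1 (hl ▸ hA)).1
    exact h l (Finset.mem_filter.1 h1).1 (Finset.mem_filter.1 h2).1
  · have h1 := Finset.mem_filter.1 (maxOption_eq_some.1 hA).1
    have h2 := Finset.mem_filter.1 (maxOption_eq_some.1 (hl ▸ hA)).1
    have h3 := Finset.mem_filter.1 (minOption_eq_some.1 hA').1
    have h4 := Finset.mem_filter.1 (minOption_eq_some.1 (hr ▸ hA')).1
    have a := h l h1.1 h2.1
    have b := h r h3.1 h4.1
    obtain ⟨p0, p1⟩ := leftProb_mem hq h1.2.1.le h3.2.1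
    dsimp only
    generalize leftProb q l r g = p at *
    rw [abs_le] at *
    constructor <;> nlinarith

/-- With distances `x`, `y` to the two neighbours the mean distance is `2xy / (x + y) ≤ 2 min x y`,
and `o` is at least as far away as the neighbour on its own side. -/
theorem stepMean_le {comp q : ι → ℕ} (hq : Monotone q) {S : Finset ι} {g o : ι}
    {f : ι → ℝ} {α β : ℝ} (hβ : 0 ≤ β) (ho : o ∈ S) (hc : comp o = comp g)
    (h : ∀ s ∈ S, comp s = comp g → f s ≤ α + β * roundDist q g s) :
    stepMean comp q S g f ≤ α + 2 * β * roundDist q g o := by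
  have hR : ∀ r, o ∈ rightSlots comp S g → minOption (rightSlots comp S g) = some r →
      r ∈ S ∧ comp r = comp g ∧ g ≤ r ∧ (q g : ℝ) ≤ q r ∧ (q r : ℝ) ≤ q o := by
    intro r hor hr
    rw [minOption_eq_some] at hr
    have h1 := Finset.mem_filter.1 hr.1
    exact ⟨h1.1, h1.2.2, h1.2.1, by exact_mod_cast hq h1.2.1, by exact_mod_cast hq (hr.2 o hor)⟩
  have hL : ∀ l, o ∈ leftSlots comp S g → maxOption (leftSlots comp S g) = some l →
      l ∈ S ∧ comp l = comp g ∧ l ≤ g ∧ (q l : ℝ) ≤ q g ∧ (q o : ℝ) ≤ q l := by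
    intro l hol hl
    rw [maxOption_eq_some] at hl
    have h1 := Finset.mem_filter.1 hl.1
    exact ⟨h1.1, h1.2.2, h1.2.1.le, by exact_mod_cast hq h1.2.1.le,
      by exact_mod_cast hq (hl.2 o hol)⟩
  have hdl : ∀ l, (q l : ℝ) ≤ q g → roundDist q g l = q g - q l := fun l hl =>
    abs_of_nonneg (sub_nonneg.2 hl)
  have hdr : ∀ r, (q g : ℝ) ≤ q r → roundDist q g r = q r - q g := fun r hr => by
    rw [roundDist, abs_sub_comm]; exact abs_of_nonneg (sub_nonneg.2 hr)
  have hor : o ∈ leftSlots comp S g ∨ o ∈ rightSlots comp S g := by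
    rcases lt_or_ge o g with h | h
    · exact Or.inl (Finset.mem_filter.2 ⟨ho, h, hc⟩)
    · exact Or.inr (Finset.mem_filter.2 ⟨ho, h, hc⟩)
  unfold stepMean
  rcases hA : maxOption (leftSlots comp S g) with _ | l <;>
    rcases hA' : minOption (rightSlots comp S g) with _ | r
  · rw [maxOption_eq_none] at hA
    rw [minOption_eq_none] at hA'
    simp [hA, hA'] at hor
  · rw [maxOption_eq_none] at hA
    obtain ⟨h1, h2, h3, h4, h5⟩ := hR r (by simpa [hA] using hor) hA'
    have := h r h1 h2
    dsimp only
    rw [hdr r h4] at this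
    rw [hdr o (h4.trans h5)]
    nlinarith
  · rw [minOption_eq_none] at hA'
    obtain ⟨h1, h2, h3, h4, h5⟩ := hL l (by simpa [hA'] using hor) hA
    have := h l h1 h2
    dsimp only
    rw [hdl l h4] at this
    rw [hdl o (h5.trans h4)]
    nlinarith
  · have h1 := Finset.mem_filter.1 (maxOption_eq_some.1 hA).1
    have h2 := Finset.mem_filter.1 (minOption_eq_some.1 hA').1
    have h3 : (q l : ℝ) ≤ q g := by exact_mod_cast hq h1.2.1.le
    have h4 : (q g : ℝ) ≤ q r := by exact_mod_cast hq h2.2.1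
    have a := h l h1.1 h1.2.2
    have b := h r h2.1 h2.2.2
    rw [hdl l h3] at a
    rw [hdr r h4] at b
    obtain ⟨p0, p1⟩ := leftProb_mem hq h1.2.1.le h2.2.1
    have pm := leftProb_mul hq h1.2.1.le h2.2.1
    dsimp only
    generalize leftProb q l r g = p at *
    have hmean : p * f l + (1 - p) * f r ≤
        α + β * (p * (q g - q l) + (1 - p) * (q r - q g)) := by nlinarith
    refine hmean.trans ?_
    have : p * (q g - q l : ℝ) + (1 - p) * (q r - q g) ≤ 2 * roundDist q g o := by
      rcases hor with ho' | ho'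
      · obtain ⟨-, -, -, h5, h6⟩ := hL l ho' hA
        rw [hdl o (h6.trans h5)]
        nlinarith
      · obtain ⟨-, -, -, h5, h6⟩ := hR r ho' hA'
        rw [hdr o (h5.trans h6)]
        nlinarith
    nlinarith

end Harmonic

/-- `A`, `C`, `B₁`, `B₂` stand for the cost difference of the two runs when the discrepancy stays,
vanishes, or grows in one of two ways; the triangle inequality reduces this to `potential_step`. -/
theorem abs_coupling_le {Δ δ δ₁ δ₂ r p₁ p₂ A B₁ B₂ C : ℝ} (hδ : 0 ≤ δ) (hΔ : 0 < Δ) (h : δ ≤ Δ)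
    (h₁ : δ ≤ δ₁) (h₂ : δ ≤ δ₂) (hr : 0 ≤ r) (hp₁ : 0 ≤ p₁) (hp₂ : 0 ≤ p₂)
    (hp : r + p₁ + p₂ ≤ 1) (hm : p₁ * δ₁ + p₂ * δ₂ ≤ (1 - r) * δ)
    (hA : |A| ≤ potential Δ δ) (hC : |C| ≤ δ)
    (hB₁ : |B₁| ≤ δ₁ - δ + potential Δ δ₁) (hB₂ : |B₂| ≤ δ₂ - δ + potential Δ δ₂) :
    |r * A + (1 - r - p₁ - p₂) * C + p₁ * B₁ + p₂ * B₂| ≤ potential Δ δ := by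
  refine le_trans ?_ (potential_step hδ hΔ h h₁ h₂ hp₁ hp₂ hm)
  refine (abs_add_le _ _).trans (add_le_add ((abs_add_le _ _).trans
    (add_le_add ((abs_add_le _ _).trans (add_le_add ?_ ?_)) ?_)) ?_)
  all_goals rw [abs_mul, abs_of_nonneg (by linarith)]
  · exact mul_le_mul_of_nonneg_left hA hr
  · exact mul_le_mul_of_nonneg_left hC (by linarith)
  · exact mul_le_mul_of_nonneg_left hB₁ hp₁
  · exact mul_le_mul_of_nonneg_left hB₂ hp₂

/-! ### Coupling of two runs and competitiveness of the harmonic algorithm. -/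

section Harmonic

variable {ι : Type*} [LinearOrder ι]

theorem comp_eq_of_between {comp : ι → ℕ} (hc : Monotone comp) {a b s : ι} (h1 : a ≤ s)
    (h2 : s ≤ b) (h : comp a = comp b) : comp s = comp a :=
  le_antisymm ((hc h2).trans h.ge) (hc h1)

/-- Two free slots between which there is no further free slot. -/
def AdjacentSlots (comp : ι → ℕ) (T : Finset ι) (a b : ι) : Prop :=
  a ∈ T ∧ b ∈ T ∧ a < b ∧ comp a = comp b ∧ ∀ s ∈ T, a < s → b ≤ s

theorem AdjacentSlots.erase {comp : ι → ℕ} {T : Finset ι} {a b s : ι}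
    (h : AdjacentSlots comp T a b) (ha : s ≠ a) (hb : s ≠ b) :
    AdjacentSlots comp (T.erase s) a b := by
  obtain ⟨h1, h2, h3, h4, h5⟩ := h
  exact ⟨Finset.mem_erase.2 ⟨ha.symm, h1⟩, Finset.mem_erase.2 ⟨hb.symm, h2⟩, h3, h4,
    fun t ht => h5 t (Finset.mem_of_mem_erase ht)⟩

/-- A grown discrepancy is a pair of neighbours of the arriving car, so the induction hypothesis for
adjacent slots applies to it again. -/
theorem adjacentSlots_of_neighbours {comp : ι → ℕ} (hc : Monotone comp) {T : Finset ι}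
    {g l r : ι} (hl : maxOption (leftSlots comp T g) = some l)
    (hr : minOption (rightSlots comp T g) = some r) : AdjacentSlots comp T l r := by
  rw [minOption_eq_some] at hr
  rw [maxOption_eq_some] at hl
  obtain ⟨hrT, hgr, hcr⟩ := Finset.mem_filter.1 hr.1
  obtain ⟨hlT, hlg, hcl⟩ := Finset.mem_filter.1 hl.1
  refine ⟨hlT, hrT, hlg.trans_le hgr, hcl.trans hcr.symm, fun s hs hls => ?_⟩
  by_contra! hsr
  have hcs : comp s = comp g :=
    (comp_eq_of_between hc hls.le hsr.le (hcl.trans hcr.symm)).trans hcl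
  rcases lt_or_ge s g with hg | hg
  · exact absurd (hl.2 s (Finset.mem_filter.2 ⟨hs, hg, hcs⟩)) hls.not_ge
  · exact absurd (hr.2 s (Finset.mem_filter.2 ⟨hs, hg, hcs⟩)) hsr.not_ge

theorem AdjacentSlots.minOption_erase {comp : ι → ℕ} {T : Finset ι}
    {a b g : ι} (h : AdjacentSlots comp T a b)
    (hr : minOption (rightSlots comp T g) = some a) :
    minOption (rightSlots comp (T.erase a) g) = some b := by
  obtain ⟨h1, h2, h3, h4, h5⟩ := h
  rw [minOption_eq_some] at hr
  have ha := Finset.mem_filter.1 hr.1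
  rw [rightSlots_erase, minOption_eq_some]
  refine ⟨Finset.mem_erase.2 ⟨h3.ne', Finset.mem_filter.2
    ⟨h2, ha.2.1.trans h3.le, h4.symm.trans ha.2.2⟩⟩, fun s hs => ?_⟩
  obtain ⟨hsa, hs⟩ := Finset.mem_erase.1 hs
  exact h5 s (Finset.mem_filter.1 hs).1 (lt_of_le_of_ne (hr.2 s hs) (Ne.symm hsa))

theorem AdjacentSlots.maxOption_erase {comp : ι → ℕ} {T : Finset ι}
    {a b g : ι} (h : AdjacentSlots comp T a b)
    (hl : maxOption (leftSlots comp T g) = some b) :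
    maxOption (leftSlots comp (T.erase b) g) = some a := by
  obtain ⟨h1, h2, h3, h4, h5⟩ := h
  rw [maxOption_eq_some] at hl
  have hb := Finset.mem_filter.1 hl.1
  rw [leftSlots_erase, maxOption_eq_some]
  refine ⟨Finset.mem_erase.2 ⟨h3.ne, Finset.mem_filter.2
    ⟨h1, h3.trans hb.2.1, h4.trans hb.2.2⟩⟩, fun s hs => ?_⟩
  obtain ⟨hsb, hs⟩ := Finset.mem_erase.1 hs
  by_contra! has
  exact hsb (le_antisymm (hl.2 s hs) (h5 s (Finset.mem_filter.1 hs).1 has))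

/-- The right neighbour of `g` is `b` if and only if its left neighbour is `a`. -/
theorem AdjacentSlots.maxOption_eq_iff {comp : ι → ℕ} {T : Finset ι}
    {a b g : ι} (h : AdjacentSlots comp T a b) :
    maxOption (leftSlots comp T g) = some a ↔ minOption (rightSlots comp T g) = some b := by
  obtain ⟨h1, h2, h3, h4, h5⟩ := h
  rw [maxOption_eq_some, minOption_eq_some]
  simp only [leftSlots, rightSlots, Finset.mem_filter]
  constructor
  · rintro ⟨⟨-, h6, h7⟩, h8⟩
    refine ⟨⟨h2, ?_, h4.symm.trans h7⟩, fun s hs => h5 s hs.1 (h6.trans_le hs.2.1)⟩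
    by_contra! hbg
    exact (h8 b ⟨h2, hbg, h4.symm.trans h7⟩).not_gt h3
  · rintro ⟨⟨-, h6, h7⟩, h8⟩
    refine ⟨⟨h1, ?_, h4.trans h7⟩, fun s hs => ?_⟩
    · by_contra! hga
      exact (h8 a ⟨h1, hga, h4.trans h7⟩).not_gt h3
    · by_contra! has
      exact absurd (h5 s hs.1 has) (hs.2.1.trans_le h6).not_ge

theorem stepMean_some_some {comp q : ι → ℕ} {S : Finset ι} {g l r : ι} {f : ι → ℝ}
    (hl : maxOption (leftSlots comp S g) = some l)
    (hr : minOption (rightSlots comp S g) = some r) :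
    stepMean comp q S g f = leftProb q l r g * f l + (1 - leftProb q l r g) * f r := by
  simp [stepMean, hl, hr]

theorem stepMean_some_none {comp q : ι → ℕ} {S : Finset ι} {g l : ι} {f : ι → ℝ}
    (hl : maxOption (leftSlots comp S g) = some l)
    (hr : minOption (rightSlots comp S g) = none) : stepMean comp q S g f = f l := by
  simp [stepMean, hl, hr]

theorem stepMean_none_some {comp q : ι → ℕ} {S : Finset ι} {g r : ι} {f : ι → ℝ}
    (hl : maxOption (leftSlots comp S g) = none)
    (hr : minOption (rightSlots comp S g) = some r) : stepMean comp q S g f = f r := by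
  simp [stepMean, hl, hr]

/-- Together with `leftProb_mono_left` this makes the probabilities of the coupled events
nonnegative and their sum at most `1`. -/
theorem leftProb_mono_right {q : ι → ℕ} (hq : Monotone q) {l g a b : ι} (hl : l ≤ g)
    (ha : g ≤ a) (hab : a ≤ b) : leftProb q l a g ≤ leftProb q l b g := by
  have h1 : (q l : ℝ) ≤ q g := by exact_mod_cast hq hl
  have h2 : (q g : ℝ) ≤ q a := by exact_mod_cast hq ha
  have h3 : (q a : ℝ) ≤ q b := by exact_mod_cast hq hab
  rcases h2.eq_or_lt with h | h
  · rw [leftProb, ← h, sub_self, zero_div]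
    exact (leftProb_mem hq hl (ha.trans hab)).1
  · unfold leftProb
    rw [div_le_div_iff₀ (by linarith) (by linarith)]
    nlinarith

theorem leftProb_mono_left {q : ι → ℕ} (hq : Monotone q) {a b g r : ι} (hab : a ≤ b)
    (hb : b ≤ g) (hr : g ≤ r) : leftProb q a r g ≤ leftProb q b r g := by
  have h1 : (q a : ℝ) ≤ q b := by exact_mod_cast hq hab
  have h2 : (q b : ℝ) ≤ q g := by exact_mod_cast hq hb
  have h3 : (q g : ℝ) ≤ q r := by exact_mod_cast hq hr
  rcases h3.eq_or_lt with h | h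
  · simp [leftProb, ← h]
  · unfold leftProb
    exact div_le_div_of_nonneg_left (by linarith) (by linarith) (by linarith)

/-- Rounded distances are at most `Δ` between slots of a component that have at most `N` slots
between them. -/
def GapBound [Fintype ι] (comp q : ι → ℕ) (N : ℕ) (Δ : ℝ) : Prop :=
  ∀ a b, a < b → comp a = comp b → (Finset.univ.filter fun s => a < s ∧ s < b).card ≤ N →
    (q b : ℝ) - q a ≤ Δ

theorem AdjacentSlots.sub_le [Fintype ι] {comp q : ι → ℕ} {N : ℕ} {Δ : ℝ}
    (hgap : GapBound comp q N Δ) {T : Finset ι} {a b : ι} (h : AdjacentSlots comp T a b)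
    (hN : Tᶜ.card ≤ N) : (q b : ℝ) - q a ≤ Δ := by
  refine hgap a b h.2.2.1 h.2.2.2.1 (le_trans (Finset.card_le_card fun s hs => ?_) hN)
  rw [Finset.mem_filter] at hs
  rw [Finset.mem_compl]
  exact fun hsT => (h.2.2.2.2 s hsT hs.2.1).not_gt hs.2.2

theorem card_compl_erase [Fintype ι] {T : Finset ι} {s : ι} (hs : s ∈ T) :
    (T.erase s)ᶜ.card = Tᶜ.card + 1 := by
  rw [Finset.compl_erase, Finset.card_insert_of_notMem (by simpa using hs)]

/-- The future cost of the harmonic algorithm changes by at most the potential of the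
discrepancy, if one of two adjacent free slots is occupied instead of the other. -/
theorem abs_harmonicCost_sub_le_potential [Fintype ι] {comp q : ι → ℕ} (hc : Monotone comp)
    (hq : Monotone q) {N : ℕ} {Δ : ℝ} (hΔ : 0 < Δ) (hgap : GapBound comp q N Δ) (n : ℕ) :
    ∀ (g : Fin n → ι) (T : Finset ι) (a b : ι), AdjacentSlots comp T a b → Tᶜ.card + n ≤ N →
      |harmonicCost comp q n g (T.erase b) - harmonicCost comp q n g (T.erase a)| ≤
        potential Δ ((q b : ℝ) - q a) := by
  induction n with
  | zero =>
    intro g T a b h hN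
    have h0 : (0 : ℝ) ≤ (q b : ℝ) - q a := sub_nonneg.2 (by exact_mod_cast hq h.2.2.1.le)
    simpa [harmonicCost] using h0.trans (le_potential h0 (h.sub_le hgap (by omega)))
  | succ n ih =>
    intro g T a b h hN
    have h0 : (0 : ℝ) ≤ (q b : ℝ) - q a := sub_nonneg.2 (by exact_mod_cast hq h.2.2.1.le)
    have hδ := h.sub_le hgap (by omega)
    have hΦ := h0.trans (le_potential h0 hδ)
    have ih' : ∀ s ∈ T, ∀ u v, AdjacentSlots comp (T.erase s) u v →
        |harmonicCost comp q n (Fin.tail g) ((T.erase s).erase v) -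
          harmonicCost comp q n (Fin.tail g) ((T.erase s).erase u)| ≤
        potential Δ ((q v : ℝ) - q u) := by
      intro s hs u v huv
      exact ih _ _ u v huv (by rw [card_compl_erase hs]; omega)
    have hstay : ∀ s ∈ T, s ≠ a → s ≠ b →
        |harmonicCost comp q n (Fin.tail g) ((T.erase b).erase s) -
          harmonicCost comp q n (Fin.tail g) ((T.erase a).erase s)| ≤
        potential Δ ((q b : ℝ) - q a) := by
      intro s hs ha hb
      rw [Finset.erase_right_comm (a := b), Finset.erase_right_comm (a := a)]
      exact ih' s hs a b (h.erase ha hb)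
    unfold harmonicCost
    generalize g 0 = c
    have haT := h.1
    have hbT := h.2.1
    have hab := h.2.2.1
    have hqab : (q a : ℝ) ≤ q b := by exact_mod_cast hq hab.le
    -- The car is left of the gap: one run chooses between `L` and `a`, the other between `L` and
    -- `b`. Both take `L` with probability `x` (the discrepancy stays). With probability `y - x`
    -- only the second takes `L`, and the discrepancy becomes the pair `L`, `b`. Otherwise `a` and
    -- `b` are taken and it vanishes.
    by_cases hra : minOption (rightSlots comp T c) = some a
    · have hca : c ≤ a := (Finset.mem_filter.1 (minOption_eq_some.1 hra).1).2.1
      have hla : maxOption (leftSlots comp T c) ≠ some a := by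
        rw [Ne, h.maxOption_eq_iff, hra]; simpa using hab.ne
      have hlb : maxOption (leftSlots comp T c) ≠ some b := by
        intro e
        exact absurd ((Finset.mem_filter.1 (maxOption_eq_some.1 e).1).2.1.trans_le hca) hab.not_gt
      have r1 : minOption (rightSlots comp (T.erase b) c) = some a := by
        rw [rightSlots_erase, minOption_erase (by rw [hra]; simpa using hab.ne), hra]
      have r2 := h.minOption_erase hra
      have qca : (q c : ℝ) ≤ q a := by exact_mod_cast hq hca
      have da : roundDist q c a = q a - q c := by
        rw [roundDist, abs_sub_comm]; exact abs_of_nonneg (by linarith)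
      have db : roundDist q c b = q b - q c := by
        rw [roundDist, abs_sub_comm]; exact abs_of_nonneg (by linarith)
      rcases hL : maxOption (leftSlots comp T c) with _ | L
      · rw [stepMean_none_some (by rw [leftSlots_erase, maxOption_erase hlb, hL]) r1,
          stepMean_none_some (by rw [leftSlots_erase, maxOption_erase hla, hL]) r2, da, db,
          Finset.erase_right_comm (a := b)]
        refine le_trans (le_of_eq ?_) (le_potential h0 hδ)
        rw [← abs_of_nonneg h0, abs_sub_comm]
        congr 1
        ring
      · have hLT := Finset.mem_filter.1 (maxOption_eq_some.1 hL).1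
        have qL : (q L : ℝ) ≤ q c := by exact_mod_cast hq hLT.2.1.le
        have dL : roundDist q c L = q c - q L := abs_of_nonneg (by linarith)
        rw [stepMean_some_some (by rw [leftSlots_erase, maxOption_erase hlb, hL]) r1,
          stepMean_some_some (by rw [leftSlots_erase, maxOption_erase hla, hL]) r2, da, db, dL]
        have hLa : L ≠ a := (hLT.2.1.trans_le hca).ne
        have hLb : L ≠ b := (hLT.2.1.trans_le (hca.trans hab.le)).ne
        have w1 := hstay L hLT.1 hLa hLb
        have w2 := ih' a haT L b (adjacentSlots_of_neighbours hc
          (by rw [leftSlots_erase, maxOption_erase hla, hL]) r2)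
        rw [Finset.erase_right_comm (a := b) (b := a)]
        have x0 := leftProb_mem hq hLT.2.1.le hca
        have y0 := leftProb_mem hq hLT.2.1.le (hca.trans hab.le)
        have xm := leftProb_mul hq hLT.2.1.le hca
        have ym := leftProb_mul hq hLT.2.1.le (hca.trans hab.le)
        have xy := leftProb_mono_right hq hLT.2.1.le hca hab.le
        generalize leftProb q L a c = x at *
        generalize leftProb q L b c = y at *
        generalize harmonicCost comp q n (Fin.tail g) ((T.erase b).erase L) = W1 at *
        generalize harmonicCost comp q n (Fin.tail g) ((T.erase a).erase L) = W2 at *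
        generalize harmonicCost comp q n (Fin.tail g) ((T.erase a).erase b) = W3 at *
        have := abs_coupling_le (r := x) (p₁ := y - x) (p₂ := 0) (δ₁ := (q b : ℝ) - q L)
          (δ₂ := (q b : ℝ) - q a) (A := W1 - W2)
          (B₁ := ((q a : ℝ) - q c) - (q c - q L) + (W3 - W2)) (B₂ := 0)
          (C := ((q a : ℝ) - q c) - (q b - q c)) h0 hΔ hδ (by linarith) le_rfl x0.1
          (by linarith) le_rfl (by linarith) (by nlinarith) w1
          (by rw [abs_le]; constructor <;> linarith)
          ((abs_add_le _ _).trans (add_le_add (by rw [abs_le]; constructor <;> linarith) w2))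
          (by simpa using hΦ)
        refine le_trans (le_of_eq ?_) this
        congr 1
        ring
    -- Mirror image: the car is right of the gap.
    by_cases hlb : maxOption (leftSlots comp T c) = some b
    · have hbc : b < c := (Finset.mem_filter.1 (maxOption_eq_some.1 hlb).1).2.1
      have hrb : minOption (rightSlots comp T c) ≠ some b := by
        rw [Ne, ← h.maxOption_eq_iff, hlb]; simpa using hab.ne'
      have l1 := h.maxOption_erase hlb
      have l2 : maxOption (leftSlots comp (T.erase a) c) = some b := by
        rw [leftSlots_erase, maxOption_erase (by rw [hlb]; simpa using hab.ne'), hlb]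
      have qbc : (q b : ℝ) ≤ q c := by exact_mod_cast hq hbc.le
      have da : roundDist q c a = q c - q a := abs_of_nonneg (by linarith)
      have db : roundDist q c b = q c - q b := abs_of_nonneg (by linarith)
      rcases hR : minOption (rightSlots comp T c) with _ | R
      · rw [stepMean_some_none l1 (by rw [rightSlots_erase, minOption_erase hrb, hR]),
          stepMean_some_none l2 (by rw [rightSlots_erase, minOption_erase hra, hR]), da, db,
          Finset.erase_right_comm (a := b)]
        refine le_trans (le_of_eq ?_) (le_potential h0 hδ)
        rw [← abs_of_nonneg h0]
        congr 1
        ring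
      · have hRT := Finset.mem_filter.1 (minOption_eq_some.1 hR).1
        have qR : (q c : ℝ) ≤ q R := by exact_mod_cast hq hRT.2.1
        have dR : roundDist q c R = q R - q c := by
          rw [roundDist, abs_sub_comm]; exact abs_of_nonneg (by linarith)
        rw [stepMean_some_some l1 (by rw [rightSlots_erase, minOption_erase hrb, hR]),
          stepMean_some_some l2 (by rw [rightSlots_erase, minOption_erase hra, hR]), da, db, dR]
        have hRb : R ≠ b := (hbc.trans_le hRT.2.1).ne'
        have hRa : R ≠ a := (hab.trans (hbc.trans_le hRT.2.1)).ne'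
        have w1 := hstay R hRT.1 hRa hRb
        have w2 := ih' b hbT a R (adjacentSlots_of_neighbours hc l1
          (by rw [rightSlots_erase, minOption_erase hrb, hR]))
        rw [Finset.erase_right_comm (a := a) (b := b)]
        have x0 := leftProb_mem hq (hab.trans hbc).le hRT.2.1
        have y0 := leftProb_mem hq hbc.le hRT.2.1
        have xm := leftProb_mul hq (hab.trans hbc).le hRT.2.1
        have ym := leftProb_mul hq hbc.le hRT.2.1
        have xy := leftProb_mono_left hq hab.le hbc.le hRT.2.1
        generalize leftProb q a R c = x at *
        generalize leftProb q b R c = y at *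
        generalize harmonicCost comp q n (Fin.tail g) ((T.erase b).erase R) = W1 at *
        generalize harmonicCost comp q n (Fin.tail g) ((T.erase a).erase R) = W2 at *
        generalize harmonicCost comp q n (Fin.tail g) ((T.erase b).erase a) = W3 at *
        have := abs_coupling_le (r := 1 - y) (p₁ := y - x) (p₂ := 0) (δ₁ := (q R : ℝ) - q a)
          (δ₂ := (q b : ℝ) - q a) (A := W1 - W2)
          (B₁ := ((q R : ℝ) - q c) - (q c - q b) + (W1 - W3)) (B₂ := 0)
          (C := ((q c : ℝ) - q a) - (q c - q b)) h0 hΔ hδ (by linarith) le_rfl (by linarith)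
          (by linarith) le_rfl (by linarith) (by nlinarith) w1
          (by rw [abs_le]; constructor <;> linarith)
          ((abs_add_le _ _).trans (add_le_add (by rw [abs_le]; constructor <;> linarith) w2))
          (by simpa using hΦ)
        refine le_trans (le_of_eq ?_) this
        congr 1
        ring
    -- The car is inside the gap: one run chooses between `a` and the next slot `R` beyond `b`, the
    -- other between `b` and the next slot `L` beyond `a`. The events "`R` is taken" and "`L` is
    -- taken" are made disjoint; they lead to the pairs `a`, `R` and `L`, `b`. Otherwise the
    -- discrepancy vanishes, and it never persists. A missing `R` or `L` gets probability `0`.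
    by_cases hla : maxOption (leftSlots comp T c) = some a
    · have hrb := h.maxOption_eq_iff.1 hla
      have hac : a < c := (Finset.mem_filter.1 (maxOption_eq_some.1 hla).1).2.1
      have hcb : c ≤ b := (Finset.mem_filter.1 (minOption_eq_some.1 hrb).1).2.1
      have qac : (q a : ℝ) ≤ q c := by exact_mod_cast hq hac.le
      have qcb : (q c : ℝ) ≤ q b := by exact_mod_cast hq hcb
      have da : roundDist q c a = q c - q a := abs_of_nonneg (by linarith)
      have db : roundDist q c b = q b - q c := by
        rw [roundDist, abs_sub_comm]; exact abs_of_nonneg (by linarith)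
      have l1 : maxOption (leftSlots comp (T.erase b) c) = some a := by
        rw [leftSlots_erase, maxOption_erase hlb, hla]
      have r2 : minOption (rightSlots comp (T.erase a) c) = some b := by
        rw [rightSlots_erase, minOption_erase hra, hrb]
      have hright : ∃ p δ₁ X : ℝ, stepMean comp q (T.erase b) c (fun s => roundDist q c s +
            harmonicCost comp q n (Fin.tail g) ((T.erase b).erase s)) =
          roundDist q c a + harmonicCost comp q n (Fin.tail g) ((T.erase b).erase a) + p * X ∧
          0 ≤ p ∧ p ≤ 1 - leftProb q a b c ∧ (q b : ℝ) - q a ≤ δ₁ ∧ p * δ₁ ≤ q c - q a ∧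
          |X + roundDist q c a - roundDist q c b| ≤
            δ₁ - ((q b : ℝ) - q a) + potential Δ δ₁ := by
        rcases hR : minOption (rightSlots comp (T.erase b) c) with _ | R
        · refine ⟨0, (q b : ℝ) - q a, roundDist q c b - roundDist q c a, ?_, le_rfl, ?_, le_rfl,
            by linarith, ?_⟩
          · rw [stepMean_some_none l1 hR]; ring
          · linarith [(leftProb_mem hq hac.le hcb).2]
          · simpa using hΦ
        · have hRT := Finset.mem_filter.1 (minOption_eq_some.1 hR).1
          have hRT' := Finset.mem_erase.1 hRT.1
          have hbR : b ≤ R := h.2.2.2.2 R hRT'.2 (hac.trans_le hRT.2.1)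
          have qbR : (q b : ℝ) ≤ q R := by exact_mod_cast hq hbR
          have w := ih' b hbT a R (adjacentSlots_of_neighbours hc l1 hR)
          have dR : roundDist q c R = q R - q c := by
            rw [roundDist, abs_sub_comm]; exact abs_of_nonneg (by linarith)
          have xm := leftProb_mul hq hac.le hRT.2.1
          refine ⟨1 - leftProb q a R c, (q R : ℝ) - q a,
            roundDist q c R + harmonicCost comp q n (Fin.tail g) ((T.erase b).erase R) -
            (roundDist q c a + harmonicCost comp q n (Fin.tail g) ((T.erase b).erase a)),
            ?_, ?_, ?_, by linarith, by linarith, ?_⟩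
          · rw [stepMean_some_some l1 hR]; ring
          · linarith [(leftProb_mem hq hac.le hRT.2.1).2]
          · linarith [leftProb_mono_right hq hac.le hcb hbR]
          · rw [dR, db]
            refine le_trans (le_of_eq ?_) ((abs_add_le (((q R : ℝ) - q c) - (q b - q c)) _).trans
              (add_le_add (by rw [abs_le]; constructor <;> linarith) w))
            congr 1
            ring
      have hleft : ∃ p δ₁ X : ℝ, stepMean comp q (T.erase a) c (fun s => roundDist q c s +
            harmonicCost comp q n (Fin.tail g) ((T.erase a).erase s)) =
          roundDist q c b + harmonicCost comp q n (Fin.tail g) ((T.erase b).erase a) + p * X ∧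
          0 ≤ p ∧ p ≤ leftProb q a b c ∧ (q b : ℝ) - q a ≤ δ₁ ∧ p * δ₁ ≤ q b - q c ∧
          |roundDist q c a - roundDist q c b - X| ≤
            δ₁ - ((q b : ℝ) - q a) + potential Δ δ₁ := by
        rw [Finset.erase_right_comm (a := b)]
        rcases hL : maxOption (leftSlots comp (T.erase a) c) with _ | L
        · refine ⟨0, (q b : ℝ) - q a, roundDist q c a - roundDist q c b, ?_, le_rfl, ?_, le_rfl,
            by linarith, ?_⟩
          · rw [stepMean_none_some hL r2]; ring
          · exact (leftProb_mem hq hac.le hcb).1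
          · simpa using hΦ
        · have hLT := Finset.mem_filter.1 (maxOption_eq_some.1 hL).1
          have hLT' := Finset.mem_erase.1 hLT.1
          have hLa : L ≤ a := by
            by_contra! haL
            exact absurd (h.2.2.2.2 L hLT'.2 haL) (hLT.2.1.trans_le hcb).not_ge
          have qLa : (q L : ℝ) ≤ q a := by exact_mod_cast hq hLa
          have w := ih' a haT L b (adjacentSlots_of_neighbours hc hL r2)
          have dL : roundDist q c L = q c - q L := abs_of_nonneg (by linarith)
          have xm := leftProb_mul hq hLT.2.1.le hcb
          refine ⟨leftProb q L b c, (q b : ℝ) - q L,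
            roundDist q c L + harmonicCost comp q n (Fin.tail g) ((T.erase a).erase L) -
            (roundDist q c b + harmonicCost comp q n (Fin.tail g) ((T.erase a).erase b)),
            ?_, ?_, ?_, by linarith, by linarith, ?_⟩
          · rw [stepMean_some_some hL r2]; ring
          · exact (leftProb_mem hq hLT.2.1.le hcb).1
          · exact leftProb_mono_left hq hLa hac.le hcb
          · rw [dL, da]
            refine le_trans (le_of_eq ?_) ((abs_add_le (((q c : ℝ) - q a) - (q c - q L)) _).trans
              (add_le_add (by rw [abs_le]; constructor <;> linarith) w))
            congr 1
            ring
      obtain ⟨p₁, δ₁, X₁, e₁, a₁, b₁, c₁, m₁, n₁⟩ := hright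
      obtain ⟨p₂, δ₂, X₂, e₂, a₂, b₂, c₂, m₂, n₂⟩ := hleft
      rw [e₁, e₂]
      have := abs_coupling_le (r := 0) (A := 0) (C := roundDist q c a - roundDist q c b)
        h0 hΔ hδ c₁ c₂ le_rfl a₁ a₂ (by linarith) (by linarith) (by simpa using hΦ)
        (by rw [da, db, abs_le]; constructor <;> linarith) n₁ n₂
      refine le_trans (le_of_eq ?_) this
      congr 1
      ring
    -- Neither `a` nor `b` is a neighbour of the car, so both runs make the same choice.
    · have hrb : minOption (rightSlots comp T c) ≠ some b := by
        rwa [Ne, ← h.maxOption_eq_iff]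
      refine stepMean_congr hq hΦ ?_ ?_ fun s hs hs' => ?_
      · rw [leftSlots_erase, leftSlots_erase, maxOption_erase hlb, maxOption_erase hla]
      · rw [rightSlots_erase, rightSlots_erase, minOption_erase hrb, minOption_erase hra]
      · rw [Finset.mem_erase] at hs hs'
        rw [add_sub_add_left_eq_sub]
        exact hstay s hs.2 hs'.1 hs.1

/-- Telescoping over the free slots from `a` to `b`, with induction on `b`: the step goes from `b`
to its predecessor in `T`. -/
theorem abs_harmonicCost_sub_le [Fintype ι] {comp q : ι → ℕ} (hc : Monotone comp)
    (hq : Monotone q) {N : ℕ} {Δ : ℝ} (hΔ : 1 ≤ Δ) (hgap : GapBound comp q N Δ) {n : ℕ}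
    (g : Fin n → ι) (T : Finset ι) (hN : Tᶜ.card + n ≤ N) {a b : ι} (ha : a ∈ T) (hb : b ∈ T)
    (hab : a < b) (hcab : comp a = comp b) :
    |harmonicCost comp q n g (T.erase b) - harmonicCost comp q n g (T.erase a)| ≤
      (1 + 2 * Real.log Δ) * ((q b : ℝ) - q a) := by
  induction b using WellFoundedLT.induction with
  | ind b ih =>
    have hne : (T.filter (· < b)).Nonempty := ⟨a, Finset.mem_filter.2 ⟨ha, hab⟩⟩
    obtain ⟨hcT, hcb⟩ := Finset.mem_filter.1 (Finset.max'_mem _ hne)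
    have hac : a ≤ (T.filter (· < b)).max' hne :=
      Finset.le_max' _ _ (Finset.mem_filter.2 ⟨ha, hab⟩)
    have hmax : ∀ s ∈ T, (T.filter (· < b)).max' hne < s → b ≤ s := by
      intro s hs hlt
      by_contra! hsb
      exact hlt.not_ge (Finset.le_max' _ _ (Finset.mem_filter.2 ⟨hs, hsb⟩))
    generalize (T.filter (· < b)).max' hne = c at *
    have hcc := comp_eq_of_between hc hac hcb.le hcab
    have h1 := abs_harmonicCost_sub_le_potential hc hq (by linarith) hgap n g T c b
      ⟨hcT, hb, hcb, hcc.trans hcab, hmax⟩ hN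
    have h2 : potential Δ ((q b : ℝ) - q c) ≤ (1 + 2 * Real.log Δ) * ((q b : ℝ) - q c) := by
      refine potential_le (by linarith) ?_
      rcases (hq hcb.le).eq_or_lt with h | h
      · exact Or.inl (by rw [h, sub_self])
      · right
        have : (q c : ℝ) + 1 ≤ q b := by exact_mod_cast h
        linarith
    rcases hac.eq_or_lt with rfl | hac
    · exact h1.trans h2
    · have h3 := ih c hcb hcT hac hcc.symm
      refine (abs_sub_le _ (harmonicCost comp q n g (T.erase c)) _).trans ?_
      linarith

theorem harmonicCost_erase_le [Fintype ι] {comp q : ι → ℕ} (hc : Monotone comp)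
    (hq : Monotone q) {N : ℕ} {Δ : ℝ} (hΔ : 1 ≤ Δ) (hgap : GapBound comp q N Δ) {n : ℕ}
    (g : Fin n → ι) (T : Finset ι) (hN : Tᶜ.card + n ≤ N) {a b : ι} (ha : a ∈ T) (hb : b ∈ T)
    (hcab : comp a = comp b) :
    harmonicCost comp q n g (T.erase a) ≤
      harmonicCost comp q n g (T.erase b) + (1 + 2 * Real.log Δ) * roundDist q a b := by
  rcases lt_trichotomy a b with h | rfl | h
  · have h1 := abs_le.1 (abs_harmonicCost_sub_le hc hq hΔ hgap g T hN ha hb h hcab)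
    have h2 : (q a : ℝ) ≤ q b := by exact_mod_cast hq h.le
    rw [roundDist, abs_sub_comm, abs_of_nonneg (sub_nonneg.2 h2)]
    linarith
  · simp [roundDist]
  · have h1 := abs_le.1 (abs_harmonicCost_sub_le hc hq hΔ hgap g T hN hb ha h hcab.symm)
    have h2 : (q b : ℝ) ≤ q a := by exact_mod_cast hq h.le
    rw [roundDist, abs_of_nonneg (sub_nonneg.2 h2)]
    linarith

/-- The harmonic algorithm is `O(log Δ)`-competitive for the rounded distances. -/
theorem harmonicCost_le [Fintype ι] {comp q : ι → ℕ} (hc : Monotone comp)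
    (hq : Monotone q) {N : ℕ} {Δ : ℝ} (hΔ : 1 ≤ Δ) (hgap : GapBound comp q N Δ) (n : ℕ) :
    ∀ (g o : Fin n → ι) (S : Finset ι), Function.Injective o → (∀ i, o i ∈ S) →
      (∀ i, comp (o i) = comp (g i)) → Sᶜ.card + n ≤ N →
      harmonicCost comp q n g S ≤
        (3 * (1 + 2 * Real.log Δ) + 2) * ∑ i, roundDist q (g i) (o i) := by
  have hK : 0 ≤ 1 + 2 * Real.log Δ := by linarith [Real.log_nonneg hΔ]
  induction n with
  | zero => intro g o S _ _ _ _; simp [harmonicCost]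
  | succ n ih =>
    intro g o S ho hoS hoc hN
    have h1 := ih (Fin.tail g) (Fin.tail o) (S.erase (o 0))
      (fun i j hij => Fin.succ_injective _ (ho hij))
      (fun i => Finset.mem_erase.2 ⟨fun e => Fin.succ_ne_zero i (ho e), hoS _⟩)
      (fun i => hoc _) (by rw [card_compl_erase (hoS 0)]; omega)
    rw [Fin.sum_univ_succ]
    unfold harmonicCost
    -- Moving the first car from `s` to `o 0` changes the future cost by at most `K` times their
    -- distance, with `K = 1 + 2 log Δ`. Going through `g 0` splits this into `K` times each leg,
    -- whence `β = 1 + K` and the total factor `2β + K = 3K + 2`.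
    have h2 := stepMean_le (f := fun s =>
        roundDist q (g 0) s + harmonicCost comp q n (Fin.tail g) (S.erase s))
      (α := harmonicCost comp q n (Fin.tail g) (S.erase (o 0)) +
        (1 + 2 * Real.log Δ) * roundDist q (g 0) (o 0)) (β := 1 + (1 + 2 * Real.log Δ))
      hq (by linarith) (hoS 0) (hoc 0) (fun s hs hsc => by
        have h3 := harmonicCost_erase_le hc hq hΔ hgap (Fin.tail g) S (by omega) hs (hoS 0)
          (hsc.trans (hoc 0).symm)
        have h4 : roundDist q s (o 0) ≤ roundDist q (g 0) s + roundDist q (g 0) (o 0) := by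
          unfold roundDist
          rw [abs_sub_comm (q (g 0) : ℝ) (q s)]
          exact abs_sub_le _ _ _
        nlinarith)
    simp only [Fin.tail] at h1
    linarith

end Harmonic

/-! ### Sampling the harmonic choice from one uniform random number per car. -/

theorem sum_range_ite_mod_lt {D k N : ℕ} (hD : 0 < D) (hk : k ≤ D) (hN : D ∣ N) (A B : ℝ) :
    ∑ u ∈ Finset.range N, (if u % D < k then A else B) =
      N * ((k : ℝ) / D * A + (1 - (k : ℝ) / D) * B) := by
  obtain ⟨M, rfl⟩ := hN
  have hD' : (D : ℝ) ≠ 0 := by exact_mod_cast hD.ne'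
  have hblock : ∑ u ∈ Finset.range D, (if u < k then A else B) = k * A + (D - k : ℝ) * B := by
    obtain ⟨e, rfl⟩ := Nat.exists_eq_add_of_le hk
    rw [Finset.sum_range_add, Finset.sum_congr rfl fun u hu => if_pos (Finset.mem_range.1 hu)]
    simp
  induction M with
  | zero => simp
  | succ M ih =>
    rw [Nat.mul_succ, Finset.sum_range_add, ih]
    have : ∀ u ∈ Finset.range D, (if (D * M + u) % D < k then A else B) =
        if u < k then A else B := by
      intro u hu
      rw [Nat.mul_add_mod, Nat.mod_eq_of_lt (Finset.mem_range.1 hu)]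
    rw [Finset.sum_congr rfl this, hblock]
    push_cast
    field_simp

/-- Every component has at least as many slots in `S` as there are cars with a destination in it. -/
def ComponentwiseFeasible {ι : Type*} {n : ℕ} (comp : ι → ℕ) (g : Fin n → ι)
    (S : Finset ι) : Prop :=
  ∀ k, (Finset.univ.filter fun i => comp (g i) = k).card ≤ (S.filter fun s => comp s = k).card

theorem ComponentwiseFeasible.exists_mem {ι : Type*} {comp : ι → ℕ} {S : Finset ι} {n : ℕ}
    {g : Fin (n + 1) → ι}
    (h : ComponentwiseFeasible comp g S) : ∃ s ∈ S, comp s = comp (g 0) := by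
  have h1 : 0 < (S.filter fun s => comp s = comp (g 0)).card :=
    lt_of_lt_of_le (Finset.card_pos.2 ⟨0, by simp⟩) (h (comp (g 0)))
  obtain ⟨s, hs⟩ := Finset.card_pos.1 h1
  exact ⟨s, (Finset.mem_filter.1 hs).1, (Finset.mem_filter.1 hs).2⟩

section Choice

variable {ι : Type*} [LinearOrder ι]

/-- The slot chosen by a car with destination `g`, if the slots of `S` are free and `u` is the
random number for this car. -/
def parkChoice (comp q : ι → ℕ) (u : ℕ) (S : Finset ι) (g : ι) : ι :=
  match maxOption (S.filter (· < g)), minOption (S.filter (g ≤ ·)) with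
  | some l, some r =>
    if comp l = comp g ∧ (comp r = comp g → u % (q r - q l) < q r - q g) then l else r
  | some l, none => l
  | none, some r => r
  | none, none => g

variable {comp q : ι → ℕ} {u : ℕ} {S : Finset ι} {g : ι}

theorem parkChoice_mem (hS : S.Nonempty) : parkChoice comp q u S g ∈ S := by
  unfold parkChoice
  rcases hl : maxOption (S.filter (· < g)) with _ | l <;>
    rcases hr : minOption (S.filter (g ≤ ·)) with _ | r
  · rw [maxOption_eq_none, Finset.filter_eq_empty_iff] at hl
    rw [minOption_eq_none, Finset.filter_eq_empty_iff] at hr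
    obtain ⟨s, hs⟩ := hS
    exact absurd (not_lt.1 (hl hs)) (hr hs)
  · exact (Finset.mem_filter.1 (minOption_eq_some.1 hr).1).1
  · exact (Finset.mem_filter.1 (maxOption_eq_some.1 hl).1).1
  · dsimp only
    split_ifs
    · exact (Finset.mem_filter.1 (maxOption_eq_some.1 hl).1).1
    · exact (Finset.mem_filter.1 (minOption_eq_some.1 hr).1).1

theorem parkChoice_le {s : ι} (hs : s ∈ S) (hgs : g ≤ s) : parkChoice comp q u S g ≤ s := by
  have hs' : s ∈ S.filter (g ≤ ·) := Finset.mem_filter.2 ⟨hs, hgs⟩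
  unfold parkChoice
  rcases hl : maxOption (S.filter (· < g)) with _ | l <;>
    rcases hr : minOption (S.filter (g ≤ ·)) with _ | r
  · exact hgs
  · exact (minOption_eq_some.1 hr).2 s hs'
  · exact ((Finset.mem_filter.1 (maxOption_eq_some.1 hl).1).2.trans_le hgs).le
  · dsimp only
    split_ifs
    · exact ((Finset.mem_filter.1 (maxOption_eq_some.1 hl).1).2.trans_le hgs).le
    · exact (minOption_eq_some.1 hr).2 s hs'

theorem le_parkChoice {s : ι} (hs : s ∈ S) (hsg : s < g) : s ≤ parkChoice comp q u S g := by
  have hs' : s ∈ S.filter (· < g) := Finset.mem_filter.2 ⟨hs, hsg⟩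
  unfold parkChoice
  rcases hl : maxOption (S.filter (· < g)) with _ | l <;>
    rcases hr : minOption (S.filter (g ≤ ·)) with _ | r
  · exact hsg.le
  · exact hsg.le.trans (Finset.mem_filter.1 (minOption_eq_some.1 hr).1).2
  · exact (maxOption_eq_some.1 hl).2 s hs'
  · dsimp only
    split_ifs
    · exact (maxOption_eq_some.1 hl).2 s hs'
    · exact hsg.le.trans (Finset.mem_filter.1 (minOption_eq_some.1 hr).1).2

theorem parkChoice_self (hg : g ∈ S) : parkChoice comp q u S g = g := by
  have hr : minOption (S.filter (g ≤ ·)) = some g :=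
    minOption_eq_some.2 ⟨Finset.mem_filter.2 ⟨hg, le_rfl⟩, fun s hs => (Finset.mem_filter.1 hs).2⟩
  unfold parkChoice
  rcases hl : maxOption (S.filter (· < g)) with _ | l <;> simp [hr]

/-- Destinations separated by a free slot have choices on the proper sides of it. Otherwise both see
the same `l` and `r`, and the left choice is a threshold condition: the bound `q r - q g` decreases
in `g`, and components are intervals. -/
theorem parkChoice_mono (hc : Monotone comp) (hq : Monotone q) (u : ℕ) (S : Finset ι) :
    Monotone (parkChoice comp q u S) := by
  intro g g' hgg
  by_cases h : ∃ s ∈ S, g ≤ s ∧ s < g'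
  · obtain ⟨s, hs, h1, h2⟩ := h
    exact (parkChoice_le hs h1).trans (le_parkChoice hs h2)
  push Not at h
  have e1 : S.filter (· < g') = S.filter (· < g) := by
    ext s
    simp only [Finset.mem_filter]
    exact ⟨fun hs => ⟨hs.1, lt_of_not_ge fun hgs => (h s hs.1 hgs).not_gt hs.2⟩,
      fun hs => ⟨hs.1, hs.2.trans_le hgg⟩⟩
  have e2 : S.filter (g' ≤ ·) = S.filter (g ≤ ·) := by
    ext s
    simp only [Finset.mem_filter]
    exact ⟨fun hs => ⟨hs.1, hgg.trans hs.2⟩, fun hs => ⟨hs.1, h s hs.1 hs.2⟩⟩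
  unfold parkChoice
  rw [e1, e2]
  rcases hl : maxOption (S.filter (· < g)) with _ | l <;>
    rcases hr : minOption (S.filter (g ≤ ·)) with _ | r
  · exact hgg
  · exact le_rfl
  · exact le_rfl
  · have hlg := (Finset.mem_filter.1 (maxOption_eq_some.1 hl).1).2
    have hgr := (Finset.mem_filter.1 (minOption_eq_some.1 hr).1).2
    have hgr' : g' ≤ r := by
      have := (minOption_eq_some.1 hr).1
      rw [← e2] at this
      exact (Finset.mem_filter.1 this).2
    dsimp only
    split_ifs with h1 h2 h2
    · exact le_rfl
    · exact hlg.le.trans hgr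
    · exfalso
      have hcg : comp l = comp g :=
        (comp_eq_of_between hc hlg.le hgg h2.1).symm
      refine h1 ⟨hcg, fun hrg => ?_⟩
      have hqq := hq hgg
      have := h2.2 (by rw [hrg, ← hcg, h2.1])
      omega
    · exact le_rfl

/-- Components are intervals: if the nearest free slot lies in another component, so do all farther
ones on that side. -/
theorem maxOption_leftSlots (hc : Monotone comp) :
    maxOption (leftSlots comp S g) =
      (maxOption (S.filter (· < g))).filter (fun l => comp l = comp g) := by
  rcases hl : maxOption (S.filter (· < g)) with _ | l
  · rw [maxOption_eq_none, Finset.filter_eq_empty_iff] at hl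
    rw [Option.filter_none, maxOption_eq_none, leftSlots, Finset.filter_eq_empty_iff]
    exact fun s hs h => hl hs h.1
  · rw [maxOption_eq_some] at hl
    have h1 := Finset.mem_filter.1 hl.1
    by_cases hcl : comp l = comp g
    · simp only [Option.filter, hcl, decide_true, if_true]
      rw [maxOption_eq_some]
      refine ⟨Finset.mem_filter.2 ⟨h1.1, h1.2, hcl⟩, fun s hs => hl.2 s ?_⟩
      have := Finset.mem_filter.1 hs
      exact Finset.mem_filter.2 ⟨this.1, this.2.1⟩
    · simp only [Option.filter, hcl, decide_false]
      rw [if_neg Bool.false_ne_true, maxOption_eq_none, leftSlots, Finset.filter_eq_empty_iff]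
      intro s hs h
      have hsl := hl.2 s (Finset.mem_filter.2 ⟨hs, h.1⟩)
      exact hcl ((comp_eq_of_between hc hsl h1.2.le h.2).trans h.2)

theorem minOption_rightSlots (hc : Monotone comp) :
    minOption (rightSlots comp S g) =
      (minOption (S.filter (g ≤ ·))).filter (fun r => comp r = comp g) := by
  rcases hr : minOption (S.filter (g ≤ ·)) with _ | r
  · rw [minOption_eq_none, Finset.filter_eq_empty_iff] at hr
    rw [Option.filter_none, minOption_eq_none, rightSlots, Finset.filter_eq_empty_iff]
    exact fun s hs h => hr hs h.1
  · rw [minOption_eq_some] at hr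
    have h1 := Finset.mem_filter.1 hr.1
    by_cases hcr : comp r = comp g
    · simp only [Option.filter, hcr, decide_true, if_true]
      rw [minOption_eq_some]
      refine ⟨Finset.mem_filter.2 ⟨h1.1, h1.2, hcr⟩, fun s hs => hr.2 s ?_⟩
      have := Finset.mem_filter.1 hs
      exact Finset.mem_filter.2 ⟨this.1, this.2.1⟩
    · simp only [Option.filter, hcr, decide_false]
      rw [if_neg Bool.false_ne_true, minOption_eq_none, rightSlots, Finset.filter_eq_empty_iff]
      intro s hs h
      have hrs := hr.2 s (Finset.mem_filter.2 ⟨hs, h.1⟩)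
      exact hcr (comp_eq_of_between hc h1.2 hrs h.2.symm)

/-- The choice is harmonic in every component that has a free slot. -/
theorem sum_parkChoice (hc : Monotone comp) (hq : Monotone q) {N : ℕ}
    (hN : ∀ l r, q l < q r → q r - q l ∣ N) (h : ∃ s ∈ S, comp s = comp g) (f : ι → ℝ) :
    ∑ v : Fin N, f (parkChoice comp q v S g) = N * stepMean comp q S g f := by
  rw [Fin.sum_univ_eq_sum_range (fun v => f (parkChoice comp q v S g)) N]
  have hconst : ∀ y, (∀ v, parkChoice comp q v S g = y) →
      ∑ v ∈ Finset.range N, f (parkChoice comp q v S g) = N * f y := by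
    intro y hy
    simp [hy]
  have hne : leftSlots comp S g ≠ ∅ ∨ rightSlots comp S g ≠ ∅ := by
    obtain ⟨s, hs, hcs⟩ := h
    rcases lt_or_ge s g with hsg | hsg
    · exact Or.inl (Finset.ne_empty_of_mem (Finset.mem_filter.2 ⟨hs, hsg, hcs⟩))
    · exact Or.inr (Finset.ne_empty_of_mem (Finset.mem_filter.2 ⟨hs, hsg, hcs⟩))
  rw [Ne, ← maxOption_eq_none, Ne, ← minOption_eq_none] at hne
  unfold stepMean
  rw [maxOption_leftSlots hc, minOption_rightSlots hc] at *
  rcases hl : maxOption (S.filter (· < g)) with _ | l <;>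
    rcases hr : minOption (S.filter (g ≤ ·)) with _ | r
  · simp [hl, hr] at hne
  · have hcr : comp r = comp g := by
      by_contra hcr
      simp [hl, hr, Option.filter, hcr] at hne
    simp only [Option.filter, hcr, decide_true, if_true]
    exact hconst r fun v => by simp [parkChoice, hl, hr]
  · have hcl : comp l = comp g := by
      by_contra hcl
      simp [hl, hr, Option.filter, hcl] at hne
    simp only [Option.filter, hcl, decide_true, if_true]
    exact hconst l fun v => by simp [parkChoice, hl, hr]
  · by_cases hcl : comp l = comp g <;> by_cases hcr : comp r = comp g
    · simp only [Option.filter, hcl, hcr, decide_true, if_true]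
      have hlg := (Finset.mem_filter.1 (maxOption_eq_some.1 hl).1).2
      have hgr := (Finset.mem_filter.1 (minOption_eq_some.1 hr).1).2
      have h1 := hq hlg.le
      have h2 := hq hgr
      have hv : ∀ v, parkChoice comp q v S g = if v % (q r - q l) < q r - q g then l else r := by
        intro v; simp [parkChoice, hl, hr, hcl, hcr]
      simp only [hv, apply_ite f]
      -- For `q l = q r` the threshold is `0`, so `r` is always chosen, in agreement with `leftProb`
      -- being `0`.
      rcases (h1.trans h2).eq_or_lt with heq | hlt
      · have h3 : q r - q g = 0 := by omega
        have h4 : leftProb q l r g = 0 := by simp [leftProb, show q r = q g by omega]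
        simp [h3, h4]
      · rw [sum_range_ite_mod_lt (Nat.sub_pos_of_lt hlt) (by omega) (hN l r hlt), leftProb,
          Nat.cast_sub h2, Nat.cast_sub hlt.le]
    · simp only [Option.filter, hcl, hcr, decide_true, decide_false, if_true]
      exact hconst l fun v => by simp [parkChoice, hl, hr, hcl, hcr]
    · simp only [Option.filter, hcl, hcr, decide_true, decide_false, if_true]
      exact hconst r fun v => by simp [parkChoice, hl, hr, hcl]
    · simp [hl, hr, Option.filter, hcl, hcr] at hne

theorem comp_parkChoice (hc : Monotone comp) (h : ∃ s ∈ S, comp s = comp g) :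
    comp (parkChoice comp q u S g) = comp g := by
  obtain ⟨s, hs, hcs⟩ := h
  unfold parkChoice
  rcases hl : maxOption (S.filter (· < g)) with _ | l <;>
    rcases hr : minOption (S.filter (g ≤ ·)) with _ | r
  · rfl
  · rw [maxOption_eq_none, Finset.filter_eq_empty_iff] at hl
    rw [minOption_eq_some] at hr
    exact (comp_eq_of_between hc (Finset.mem_filter.1 hr.1).2
      (hr.2 s (Finset.mem_filter.2 ⟨hs, not_lt.1 (hl hs)⟩)) hcs.symm)
  · rw [minOption_eq_none, Finset.filter_eq_empty_iff] at hr
    rw [maxOption_eq_some] at hl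
    exact (comp_eq_of_between hc (hl.2 s (Finset.mem_filter.2 ⟨hs, not_le.1 (hr hs)⟩))
      (Finset.mem_filter.1 hl.1).2.le hcs).trans hcs
  · dsimp only
    split_ifs with h1
    · exact h1.1
    · by_contra hcr
      rw [minOption_eq_some] at hr
      rw [maxOption_eq_some] at hl
      rcases lt_or_ge s g with hsg | hsg
      · refine h1 ⟨?_, fun e => absurd e hcr⟩
        exact (comp_eq_of_between hc (hl.2 s (Finset.mem_filter.2 ⟨hs, hsg⟩))
          (Finset.mem_filter.1 hl.1).2.le hcs).trans hcs
      · exact hcr (comp_eq_of_between hc (Finset.mem_filter.1 hr.1).2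
          (hr.2 s (Finset.mem_filter.2 ⟨hs, hsg⟩)) hcs.symm)

/-- A car parking in its own component uses up one slot and one demand there. Hence no car ever
meets a full component, and every choice is truly harmonic. -/
theorem ComponentwiseFeasible.tail {n : ℕ} {g : Fin (n + 1) → ι}
    (h : ComponentwiseFeasible comp g S) {s : ι} (hs : s ∈ S) (hcs : comp s = comp (g 0)) :
    ComponentwiseFeasible comp (Fin.tail g) (S.erase s) := by
  intro k
  have h1 := h k
  rw [Fin.card_filter_univ_succ] at h1
  rw [Finset.filter_erase]
  change (Finset.univ.filter fun i : Fin n => comp (g i.succ) = k).card ≤ _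
  by_cases hk : comp (g 0) = k
  · rw [if_pos hk] at h1
    rw [Finset.card_erase_of_mem (Finset.mem_filter.2 ⟨hs, hcs.trans hk⟩)]
    omega
  · rw [if_neg hk] at h1
    rw [Finset.erase_eq_of_notMem (by simp [hcs, hk])]
    exact h1

/-- The first random number is split off from `ω`; given it, the rest is the same process on the
remaining slots. Plain sums over `ω` replace expectations, hence the factor `N ^ n`. -/
theorem sum_roundDist_parkChoice (hc : Monotone comp) (hq : Monotone q) {N : ℕ}
    (hN : ∀ l r, q l < q r → q r - q l ∣ N) (n : ℕ) :
    ∀ (g : Fin n → ι) (S : Finset ι) (x : (Fin n → Fin N) → Fin n → ι),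
      ComponentwiseFeasible comp g S →
      (∀ ω i, x ω i = parkChoice comp q (ω i) (S \ occupied (x ω) i) (g i)) →
      ∑ ω, ∑ i, roundDist q (g i) (x ω i) = (N : ℝ) ^ n * harmonicCost comp q n g S := by
  induction n with
  | zero => intro g S x _ _; simp [harmonicCost]
  | succ n ih =>
    intro g S x hf hx
    have hex := hf.exists_mem
    have hne : S.Nonempty := hex.imp fun _ h => h.1
    have hx0 : ∀ u ω, x (Fin.cons u ω) 0 = parkChoice comp q u S (g 0) := by
      intro u ω
      have h0 : Finset.Iio (0 : Fin (n + 1)) = ∅ := by ext; simp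
      rw [hx]
      simp [occupied, h0]
    have htail : ∀ u : Fin N, ∑ ω, ∑ i : Fin n,
        roundDist q (g i.succ) (x (Fin.cons u ω) i.succ) = (N : ℝ) ^ n *
          harmonicCost comp q n (Fin.tail g) (S.erase (parkChoice comp q u S (g 0))) := by
      intro u
      refine ih (Fin.tail g) _ (fun ω i => x (Fin.cons u ω) i.succ)
        (hf.tail (parkChoice_mem hne) (comp_parkChoice hc hex)) fun ω i => ?_
      rw [hx]
      simp only [Fin.cons_succ, Fin.tail]
      congr 1
      ext s
      simp only [occupied, Finset.mem_sdiff, Finset.mem_image, Finset.mem_Iio, Finset.mem_erase,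
        Fin.exists_fin_succ, hx0, Fin.succ_lt_succ_iff, Fin.succ_pos, true_and, not_or]
      tauto
    have hcons : ∀ (u : Fin N) (ω : Fin n → Fin N),
        (Fin.consEquiv fun _ => Fin N) (u, ω) = Fin.cons u ω := fun _ _ => rfl
    rw [← (Fin.consEquiv fun _ => Fin N).sum_comp, Fintype.sum_prod_type]
    simp only [hcons, Fin.sum_univ_succ, hx0, Finset.sum_add_distrib, htail]
    rw [harmonicCost, pow_succ, mul_assoc, ← sum_parkChoice hc hq hN hex]
    simp [Finset.sum_add_distrib, mul_add, Finset.mul_sum]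

end Choice

/-! ### Distances in a weighted path graph -/

/-- The weight of the edge between the vertices `k` and `k + 1`. -/
def lineWeight {m : ℕ} (w : Sym2 (Fin m) → ℝ) (k : ℕ) : ℝ :=
  if h : k + 1 < m then w s(⟨k, k.lt_succ_self.trans h⟩, ⟨k + 1, h⟩) else 1

/-- The distance of the vertex `k` from the left end of the path. -/
def linePos {m : ℕ} (w : Sym2 (Fin m) → ℝ) (k : ℕ) : ℝ := ∑ j ∈ Finset.range k, lineWeight w j

section Line

variable {m : ℕ} {w : Sym2 (Fin m) → ℝ}

theorem linePos_succ (k : ℕ) : linePos w (k + 1) = linePos w k + lineWeight w k :=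
  Finset.sum_range_succ _ _

theorem linePos_sub {a b : ℕ} (h : a ≤ b) :
    linePos w b - linePos w a = ∑ k ∈ Finset.Ico a b, lineWeight w k := by
  rw [linePos, linePos, Finset.sum_Ico_eq_sub _ h]

theorem lineWeight_pos (hw : ∀ e ∈ (SimpleGraph.pathGraph m).edgeSet, 0 < w e) (k : ℕ) :
    0 < lineWeight w k := by
  unfold lineWeight
  split_ifs with h
  · refine hw _ ?_
    rw [SimpleGraph.mem_edgeSet, SimpleGraph.pathGraph_adj]
    exact Or.inl rfl
  · exact one_pos

/-- The default weight `1` beyond the right end makes this true on all of `ℕ`. -/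
theorem linePos_strictMono (hw : ∀ e ∈ (SimpleGraph.pathGraph m).edgeSet, 0 < w e) :
    StrictMono (linePos w) :=
  strictMono_nat_of_lt_succ fun k => by
    rw [linePos_succ]; exact lt_add_of_pos_right _ (lineWeight_pos hw k)

theorem abs_linePos_sub_of_adj (hw : ∀ e ∈ (SimpleGraph.pathGraph m).edgeSet, 0 < w e)
    {u v : Fin m} (h : (SimpleGraph.pathGraph m).Adj u v) :
    |linePos w u - linePos w v| = w s(u, v) := by
  have key : ∀ a b : Fin m, (a : ℕ) + 1 = b → linePos w b - linePos w a = w s(a, b) := by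
    intro a b hab
    obtain ⟨b, hb⟩ := b
    subst hab
    rw [linePos_succ, add_sub_cancel_left, lineWeight, dif_pos hb]
  have hpos := hw s(u, v) h
  rw [SimpleGraph.pathGraph_adj] at h
  rcases h with h | h
  · rw [abs_sub_comm, key u v h, abs_of_pos hpos]
  · rw [key v u h, Sym2.eq_swap, abs_of_pos hpos]

theorem abs_linePos_sub_le_walk (hw : ∀ e ∈ (SimpleGraph.pathGraph m).edgeSet, 0 < w e)
    {u v : Fin m} (p : (SimpleGraph.pathGraph m).Walk u v) :
    |linePos w u - linePos w v| ≤ (p.edges.map w).sum := by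
  induction p with
  | nil => simp
  | cons h p ih =>
    rw [SimpleGraph.Walk.edges_cons, List.map_cons, List.sum_cons, ← abs_linePos_sub_of_adj hw h]
    exact (abs_sub_le _ _ _).trans (add_le_add_right ih _)

theorem exists_path_weight (hw : ∀ e ∈ (SimpleGraph.pathGraph m).edgeSet, 0 < w e) (k : ℕ) :
    ∀ u v : Fin m, (u : ℕ) + k = v → ∃ p : (SimpleGraph.pathGraph m).Walk u v, p.IsPath ∧
      (∀ x ∈ p.support, u ≤ x) ∧ (p.edges.map w).sum = linePos w v - linePos w u := by
  induction k with
  | zero =>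
    intro u v h
    obtain rfl : u = v := Fin.ext h
    exact ⟨.nil, by simp, by simp, by simp⟩
  | succ k ih =>
    intro u v h
    have hu : (u : ℕ) + 1 < m := lt_of_le_of_lt (by omega) v.isLt
    obtain ⟨p, hp, hs, hsum⟩ := ih ⟨u + 1, hu⟩ v (by simp only; omega)
    have hadj : (SimpleGraph.pathGraph m).Adj u ⟨u + 1, hu⟩ :=
      SimpleGraph.pathGraph_adj.2 (Or.inl rfl)
    have hlt : u < ⟨u + 1, hu⟩ := Fin.lt_def.2 (Nat.lt_succ_self _)
    refine ⟨.cons hadj p, ?_, ?_, ?_⟩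
    · rw [SimpleGraph.Walk.cons_isPath_iff]
      exact ⟨hp, fun hmem => (hs u hmem).not_gt hlt⟩
    · intro x hx
      rw [SimpleGraph.Walk.support_cons, List.mem_cons] at hx
      rcases hx with rfl | hx
      · exact le_rfl
      · exact hlt.le.trans (hs x hx)
    · have h1 := abs_linePos_sub_of_adj hw hadj
      rw [SimpleGraph.Walk.edges_cons, List.map_cons, List.sum_cons, hsum, ← h1, abs_sub_comm,
        abs_of_pos (sub_pos.2 (linePos_strictMono hw hlt))]
      ring

theorem graphDist_pathGraph (hw : ∀ e ∈ (SimpleGraph.pathGraph m).edgeSet, 0 < w e)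
    (u v : Fin m) :
    graphDist (SimpleGraph.pathGraph m) w u v = |linePos w u - linePos w v| := by
  have hex : ∃ p : (SimpleGraph.pathGraph m).Walk u v, p.IsPath ∧
      (p.edges.map w).sum = |linePos w u - linePos w v| := by
    rcases le_total u v with h | h
    · obtain ⟨p, hp, -, hsum⟩ := exists_path_weight hw _ u v (Nat.add_sub_cancel' h)
      refine ⟨p, hp, ?_⟩
      rw [hsum, abs_sub_comm, abs_of_nonneg (sub_nonneg.2 ((linePos_strictMono hw).monotone h))]
    · obtain ⟨p, hp, -, hsum⟩ := exists_path_weight hw _ v u (Nat.add_sub_cancel' h)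
      refine ⟨p.reverse, hp.reverse, ?_⟩
      rw [SimpleGraph.Walk.edges_reverse, List.map_reverse, List.sum_reverse, hsum,
        abs_of_nonneg (sub_nonneg.2 ((linePos_strictMono hw).monotone h))]
  obtain ⟨p, hp, hsum⟩ := hex
  have : Nonempty ((SimpleGraph.pathGraph m).Path u v) := ⟨⟨p, hp⟩⟩
  unfold graphDist
  refine le_antisymm ?_ (le_ciInf fun p => abs_linePos_sub_le_walk hw p.1)
  rw [← hsum]
  exact ciInf_le ⟨0, by
    rintro _ ⟨p, rfl⟩
    exact (abs_nonneg _).trans (abs_linePos_sub_le_walk hw p.1)⟩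
    (⟨p, hp⟩ : (SimpleGraph.pathGraph m).Path u v)

/-! ### Prices that implement a monotone choice of slots -/

/-- The slope on the edge between `k` and `k + 1` of the prices that implement `φ`. -/
noncomputable def priceSlope {m : ℕ} (φ : Fin m → Fin m) (k : ℕ) : ℝ :=
  if h : k + 1 < m then
    if φ ⟨k, k.lt_succ_self.trans h⟩ = φ ⟨k + 1, h⟩ then
      if (φ ⟨k, k.lt_succ_self.trans h⟩ : ℕ) ≤ k then 1 else -1
    else 0
  else 0

/-- The prices that implement `φ`. -/
noncomputable def implementingPrice {m : ℕ} (w : Sym2 (Fin m) → ℝ) (φ : Fin m → Fin m)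
    (v : Fin m) : ℝ :=
  ∑ k ∈ Finset.range v, priceSlope φ k * lineWeight w k

theorem abs_priceSlope_le (φ : Fin m → Fin m) (k : ℕ) : |priceSlope φ k| ≤ 1 := by
  unfold priceSlope
  split_ifs <;> simp

theorem implementingPrice_sub {φ : Fin m → Fin m} {a b : Fin m} (h : a ≤ b) :
    implementingPrice w φ b - implementingPrice w φ a =
      ∑ k ∈ Finset.Ico (a : ℕ) b, priceSlope φ k * lineWeight w k := by
  rw [implementingPrice, implementingPrice, Finset.sum_Ico_eq_sub _ (Fin.le_def.1 h)]

/-- The prices differ by less than the distance between points with different choices. -/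
theorem abs_implementingPrice_sub_lt (hw : ∀ e ∈ (SimpleGraph.pathGraph m).edgeSet, 0 < w e)
    {φ : Fin m → Fin m} {a b : Fin m} (h : a ≤ b) (hne : φ a ≠ φ b) :
    |implementingPrice w φ b - implementingPrice w φ a| < linePos w b - linePos w a := by
  rw [implementingPrice_sub h, linePos_sub (Fin.le_def.1 h)]
  -- Some edge between `a` and `b` has ends with different choices; its slope is `0`, which makes
  -- the inequality strict.
  have hex : ∃ k ∈ Finset.Ico (a : ℕ) b, priceSlope φ k = 0 := by
    by_contra! hcon
    have hconst : ∀ j (hj : (a : ℕ) + j ≤ b), φ ⟨a + j, hj.trans_lt b.isLt⟩ = φ a := by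
      intro j
      induction j with
      | zero => intro _; rfl
      | succ j ih =>
        intro hj
        have h1 := hcon (a + j) (Finset.mem_Ico.2 ⟨by omega, by omega⟩)
        have h2 : (a : ℕ) + j + 1 < m := lt_of_le_of_lt hj b.isLt
        rw [← ih (by omega)]
        by_contra hne'
        exact h1 (by rw [priceSlope, dif_pos h2, if_neg fun e => hne' e.symm])
    refine hne ?_
    rw [← hconst (b - a) (by have := Fin.le_def.1 h; omega)]
    congr 1
    exact Fin.ext (by have := Fin.le_def.1 h; simp only; omega)
  obtain ⟨k, hk, hk0⟩ := hex
  refine (Finset.abs_sum_le_sum_abs _ _).trans_lt (Finset.sum_lt_sum (fun j _ => ?_) ⟨k, hk, ?_⟩)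
  · rw [abs_mul, abs_of_pos (lineWeight_pos hw j)]
    exact mul_le_of_le_one_left (lineWeight_pos hw j).le (abs_priceSlope_le φ j)
  · rw [hk0, zero_mul, abs_zero]
    exact lineWeight_pos hw k

/-- By monotonicity and idempotence `φ` is constant between `g` and `φ g`, so prices fall at full
slope towards `φ g` and exactly offset the distance. -/
theorem implementingPrice_eq {φ : Fin m → Fin m} (hmono : Monotone φ)
    (hφ : ∀ g, φ (φ g) = φ g) (hw : ∀ e ∈ (SimpleGraph.pathGraph m).edgeSet, 0 < w e) (g : Fin m) :
    |linePos w g - linePos w (φ g)| + implementingPrice w φ (φ g) = implementingPrice w φ g := by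
  have hpm := (linePos_strictMono hw).monotone
  rcases le_total (φ g) g with h | h
  · rw [abs_of_nonneg (sub_nonneg.2 (hpm h)), ← eq_sub_iff_add_eq, implementingPrice_sub h,
      linePos_sub (Fin.le_def.1 h)]
    refine Finset.sum_congr rfl fun k hk => ?_
    rw [Finset.mem_Ico] at hk
    have hkm : k + 1 < m := lt_of_le_of_lt hk.2 g.isLt
    have e : ∀ j : Fin m, φ g ≤ j → j ≤ g → φ j = φ g := fun j h1 h2 =>
      le_antisymm (hmono h2) (by rw [← hφ g]; exact hmono h1)
    have e1 := e ⟨k, k.lt_succ_self.trans hkm⟩ (Fin.le_def.2 hk.1) (Fin.le_def.2 hk.2.le)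
    have e2 := e ⟨k + 1, hkm⟩ (Fin.le_def.2 (hk.1.trans k.le_succ)) (Fin.le_def.2 hk.2)
    rw [priceSlope, dif_pos hkm, e1, e2, if_pos rfl, if_pos hk.1, one_mul]
  · rw [abs_sub_comm, abs_of_nonneg (sub_nonneg.2 (hpm h)), linePos_sub (Fin.le_def.1 h)]
    have h1 := implementingPrice_sub (w := w) (φ := φ) h
    have h2 : ∑ k ∈ Finset.Ico (g : ℕ) (φ g), priceSlope φ k * lineWeight w k =
        ∑ k ∈ Finset.Ico (g : ℕ) (φ g), -lineWeight w k := by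
      refine Finset.sum_congr rfl fun k hk => ?_
      rw [Finset.mem_Ico] at hk
      have hkm : k + 1 < m := lt_of_le_of_lt hk.2 (φ g).isLt
      have e : ∀ j : Fin m, g ≤ j → j ≤ φ g → φ j = φ g := fun j h1 h2 =>
        le_antisymm (by rw [← hφ g]; exact hmono h2) (hmono h1)
      have e1 := e ⟨k, k.lt_succ_self.trans hkm⟩ (Fin.le_def.2 hk.1) (Fin.le_def.2 hk.2.le)
      have e2 := e ⟨k + 1, hkm⟩ (Fin.le_def.2 (hk.1.trans k.le_succ)) (Fin.le_def.2 hk.2)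
      rw [priceSlope, dif_pos hkm, e1, e2, if_pos rfl, if_neg (not_le.2 hk.2), neg_one_mul]
    rw [h2, Finset.sum_neg_distrib] at h1
    linarith

/-- With these prices the unique slot of minimum disutility for a car with destination `g`
is `φ g`. -/
theorem implementingPrice_lt {φ : Fin m → Fin m} (hmono : Monotone φ)
    (hφ : ∀ g, φ (φ g) = φ g) (hw : ∀ e ∈ (SimpleGraph.pathGraph m).edgeSet, 0 < w e)
    {g s : Fin m} (hs : φ s = s) (hne : s ≠ φ g) :
    |linePos w g - linePos w (φ g)| + implementingPrice w φ (φ g) <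
      |linePos w g - linePos w s| + implementingPrice w φ s := by
  have hpm := (linePos_strictMono hw).monotone
  rw [implementingPrice_eq hmono hφ hw]
  rcases le_total s g with h | h
  · have h1 := (abs_lt.1 (abs_implementingPrice_sub_lt (φ := φ) hw h (by rwa [hs]))).2
    rw [abs_of_nonneg (sub_nonneg.2 (hpm h))]
    linarith
  · have h1 := (abs_lt.1 (abs_implementingPrice_sub_lt (φ := φ) hw h (by rw [hs]; exact hne.symm))).1
    rw [abs_sub_comm, abs_of_nonneg (sub_nonneg.2 (hpm h))]
    linarith

end Line

/-! ### Optimal matchings -/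

section Opt

variable {n m : ℕ} {w : Sym2 (Fin m) → ℝ}

theorem exists_socialCost_eq_optCost (hnm : n ≤ m) (d : Fin m → Fin m → ℝ) (g : Fin n → Fin m) :
    ∃ o : Fin n ↪ Fin m, socialCost d g o = optCost d g :=
  have : Nonempty (Fin n ↪ Fin m) := ⟨Fin.castLEEmb hnm⟩
  exists_eq_ciInf_of_finite

theorem graphDist_nonneg (hw : ∀ e ∈ (SimpleGraph.pathGraph m).edgeSet, 0 < w e) (u v : Fin m) :
    0 ≤ graphDist (SimpleGraph.pathGraph m) w u v := by
  rw [graphDist_pathGraph hw]; exact abs_nonneg _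

theorem graphDist_eq_zero (hw : ∀ e ∈ (SimpleGraph.pathGraph m).edgeSet, 0 < w e) {u v : Fin m} :
    graphDist (SimpleGraph.pathGraph m) w u v = 0 ↔ u = v := by
  rw [graphDist_pathGraph hw, abs_eq_zero, sub_eq_zero, (linePos_strictMono hw).injective.eq_iff,
    Fin.val_inj]

theorem injective_of_optCost_nonpos (hnm : n ≤ m)
    (hw : ∀ e ∈ (SimpleGraph.pathGraph m).edgeSet, 0 < w e) {g : Fin n → Fin m}
    (h : optCost (graphDist (SimpleGraph.pathGraph m) w) g ≤ 0) : Function.Injective g := by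
  obtain ⟨o, ho⟩ := exists_socialCost_eq_optCost hnm (graphDist (SimpleGraph.pathGraph m) w) g
  have h1 := (Finset.sum_eq_zero_iff_of_nonneg fun i _ => graphDist_nonneg hw (g i) (o i)).1
    (le_antisymm (ho.trans_le h) (Finset.sum_nonneg fun i _ => graphDist_nonneg hw (g i) (o i)))
  have h2 : g = o := funext fun i => (graphDist_eq_zero hw).1 (h1 i (Finset.mem_univ i))
  exact h2 ▸ o.injective

/-- The scheme without fees. -/
noncomputable def zeroScheme (n m : ℕ) : PricingScheme n (Fin m) where
  Ω := Unit
  μ := Measure.dirac ()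
  price _ _ _ _ := 0
  measurable_price _ _ _ := measurable_const

/-- Without fees all cars park at their destinations if these are different. -/
theorem socialCost_zeroScheme (hw : ∀ e ∈ (SimpleGraph.pathGraph m).edgeSet, 0 < w e)
    {g x : Fin n → Fin m} (hg : Function.Injective g) {ω : (zeroScheme n m).Ω}
    (hx : x ∈ (zeroScheme n m).equilibria (graphDist (SimpleGraph.pathGraph m) w) g ω) :
    socialCost (graphDist (SimpleGraph.pathGraph m) w) g x = 0 := by
  have hxg : ∀ i, x i = g i := by
    intro i
    induction i using WellFoundedLT.induction with
    | ind i ih =>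
      have h1 : g i ∉ occupied x i := by
        simp only [occupied, Finset.mem_image, Finset.mem_Iio, not_exists, not_and]
        intro j hj he
        rw [ih j hj] at he
        exact hj.ne (hg he)
      have h2 := (hx i).2 (g i) h1
      simp only [zeroScheme, add_zero] at h2
      rw [(graphDist_eq_zero hw).2 rfl] at h2
      exact ((graphDist_eq_zero hw).1 (le_antisymm h2 (graphDist_nonneg hw _ _))).symm
  exact Finset.sum_eq_zero fun i _ => (graphDist_eq_zero hw).2 (hxg i).symm

theorem integral_socialCost_zeroScheme (hw : ∀ e ∈ (SimpleGraph.pathGraph m).edgeSet, 0 < w e)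
    {g : Fin n → Fin m} (hg : Function.Injective g) {x : (zeroScheme n m).Ω → Fin n → Fin m}
    (hx : ∀ᵐ ω ∂(zeroScheme n m).μ,
      x ω ∈ (zeroScheme n m).equilibria (graphDist (SimpleGraph.pathGraph m) w) g ω) :
    ∫ ω, socialCost (graphDist (SimpleGraph.pathGraph m) w) g (x ω) ∂(zeroScheme n m).μ = 0 :=
  integral_eq_zero_of_ae (hx.mono fun _ h => socialCost_zeroScheme hw hg h)

end Opt

/-! ### The harmonic pricing scheme -/

section Scheme

variable {n m : ℕ} {w : Sym2 (Fin m) → ℝ}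

/-- The positions of the slots, rounded to multiples of `ε`. -/
noncomputable def roundedPos (w : Sym2 (Fin m) → ℝ) (ε : ℝ) (v : Fin m) : ℕ :=
  ⌊linePos w v / ε⌋₊

/-- The components that remain when all edges of weight more than `Λ` are removed. -/
noncomputable def lineComponent (w : Sym2 (Fin m) → ℝ) (Λ : ℝ) (v : Fin m) : ℕ :=
  ((Finset.range v).filter fun k => Λ < lineWeight w k).card

theorem linePos_nonneg (hw : ∀ e ∈ (SimpleGraph.pathGraph m).edgeSet, 0 < w e) (k : ℕ) :
    0 ≤ linePos w k :=
  Finset.sum_nonneg fun j _ => (lineWeight_pos hw j).le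

theorem roundedPos_mono (hw : ∀ e ∈ (SimpleGraph.pathGraph m).edgeSet, 0 < w e) {ε : ℝ}
    (hε : 0 < ε) : Monotone (roundedPos w ε) := fun _ _ h =>
  Nat.floor_le_floor (div_le_div_of_nonneg_right ((linePos_strictMono hw).monotone h) hε.le)

theorem lineComponent_mono (Λ : ℝ) : Monotone (lineComponent w Λ) := fun _ _ h =>
  Finset.card_le_card (Finset.filter_subset_filter _ (Finset.range_subset_range.2 h))

/-- Both positions are rounded down by less than `ε`, so the errors partly cancel and the total is
`ε`, not `2ε`. -/
theorem abs_sub_roundDist_le (hw : ∀ e ∈ (SimpleGraph.pathGraph m).edgeSet, 0 < w e) {ε : ℝ}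
    (hε : 0 < ε) (u v : Fin m) :
    |graphDist (SimpleGraph.pathGraph m) w u v - ε * roundDist (roundedPos w ε) u v| ≤ ε := by
  have h : ∀ k : Fin m, ε * roundedPos w ε k ≤ linePos w k ∧
      linePos w k < ε * roundedPos w ε k + ε := by
    intro k
    have h0 : 0 ≤ linePos w k / ε := div_nonneg (linePos_nonneg hw k) hε.le
    have h1 := Nat.floor_le h0
    have h2 := Nat.lt_floor_add_one (linePos w k / ε)
    rw [le_div_iff₀ hε] at h1
    rw [div_lt_iff₀ hε] at h2
    unfold roundedPos
    constructor <;> linarith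
  have hu := h u
  have hv := h v
  rw [graphDist_pathGraph hw, roundDist, ← abs_of_pos hε, ← abs_mul, abs_of_pos hε, mul_sub]
  refine (abs_abs_sub_abs_le_abs_sub _ _).trans ?_
  rw [abs_le]
  constructor <;> linarith

theorem lineComponent_eq_of_dist_le (hw : ∀ e ∈ (SimpleGraph.pathGraph m).edgeSet, 0 < w e)
    {Λ : ℝ} {u v : Fin m} (h : graphDist (SimpleGraph.pathGraph m) w u v ≤ Λ) :
    lineComponent w Λ u = lineComponent w Λ v := by
  wlog huv : u ≤ v generalizing u v
  · refine (this ?_ (le_of_not_ge huv)).symm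
    rwa [graphDist_pathGraph hw, abs_sub_comm, ← graphDist_pathGraph hw]
  rw [graphDist_pathGraph hw, abs_sub_comm,
    abs_of_nonneg (sub_nonneg.2 ((linePos_strictMono hw).monotone huv)),
    linePos_sub (Fin.le_def.1 huv)] at h
  refine congrArg Finset.card (Finset.ext fun k => ?_)
  simp only [Finset.mem_filter, Finset.mem_range]
  refine ⟨fun hk => ⟨hk.1.trans_le huv, hk.2⟩, fun hk => ⟨?_, hk.2⟩⟩
  by_contra! hku
  have := Finset.single_le_sum (fun j _ => (lineWeight_pos hw j).le)
    (Finset.mem_Ico.2 ⟨hku, hk.1⟩)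
  linarith [hk.2]

/-- At most `n` slots in between means at most `n + 1` edges, none heavier than `Λ` within a
component; the final `1` is the rounding error. -/
theorem gapBound_line (hw : ∀ e ∈ (SimpleGraph.pathGraph m).edgeSet, 0 < w e) {ε Λ : ℝ}
    (hε : 0 < ε) (hΛ : 0 ≤ Λ) (n : ℕ) :
    GapBound (lineComponent w Λ) (roundedPos w ε) n ((n + 1) * Λ / ε + 1) := by
  intro a b hab hcomp hcard
  have hsub : ∀ k ∈ Finset.Ico (a : ℕ) b, lineWeight w k ≤ Λ := by
    intro k hk
    rw [Finset.mem_Ico] at hk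
    by_contra! hlt
    have hss : (Finset.range a).filter (fun k => Λ < lineWeight w k) ⊂
        (Finset.range b).filter (fun k => Λ < lineWeight w k) := by
      refine Finset.ssubset_iff_subset_ne.2
        ⟨Finset.filter_subset_filter _ (Finset.range_subset_range.2 hab.le), fun e => ?_⟩
      have : k ∈ (Finset.range a).filter (fun k => Λ < lineWeight w k) := by
        rw [e]; exact Finset.mem_filter.2 ⟨Finset.mem_range.2 hk.2, hlt⟩
      exact (Finset.mem_range.1 (Finset.mem_filter.1 this).1).not_ge hk.1
    exact (Finset.card_lt_card hss).ne hcomp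
  have hcard' : (b : ℕ) - a ≤ n + 1 := by
    have : (Finset.univ.filter fun s => a < s ∧ s < b) = Finset.Ioo a b := by ext; simp
    rw [this, Fin.card_Ioo] at hcard
    omega
  have hpos : linePos w b - linePos w a ≤ (n + 1) * Λ := by
    rw [linePos_sub (Fin.le_def.1 hab.le)]
    refine (Finset.sum_le_card_nsmul _ _ _ hsub).trans ?_
    rw [Nat.card_Ico, nsmul_eq_mul]
    exact mul_le_mul_of_nonneg_right (by exact_mod_cast hcard') hΛ
  have h1 := (abs_le.1 (abs_sub_roundDist_le hw hε b a)).1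
  rw [graphDist_pathGraph hw, roundDist,
    abs_of_nonneg (sub_nonneg.2 ((linePos_strictMono hw).monotone hab.le)),
    abs_of_nonneg (sub_nonneg.2 (by exact_mod_cast roundedPos_mono hw hε hab.le))] at h1
  rw [div_add_one hε.ne', le_div_iff₀ hε]
  linarith

/-- The pricing scheme that implements the harmonic algorithm. -/
noncomputable def harmonicScheme (n : ℕ) (w : Sym2 (Fin m) → ℝ) (comp q : Fin m → ℕ) (N : ℕ)
    [NeZero N] : PricingScheme n (Fin m) where
  Ω := Fin n → Fin N
  μ := (PMF.uniformOfFintype (Fin n → Fin N)).toMeasure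
  price i S v ω := implementingPrice w (parkChoice comp q (ω i) Sᶜ) v
  measurable_price _ _ _ := measurable_of_finite _

theorem eq_parkChoice_of_mem_equilibria (hw : ∀ e ∈ (SimpleGraph.pathGraph m).edgeSet, 0 < w e)
    {comp q : Fin m → ℕ} (hc : Monotone comp) (hq : Monotone q) {N : ℕ} [NeZero N]
    {g x : Fin n → Fin m} {ω : Fin n → Fin N}
    (hx : x ∈ (harmonicScheme n w comp q N).equilibria
      (graphDist (SimpleGraph.pathGraph m) w) g ω) (i : Fin n) :
    x i = parkChoice comp q (ω i) (Finset.univ \ occupied x i) (g i) := by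
  obtain ⟨h1, h2⟩ := hx i
  rw [← Finset.compl_eq_univ_sdiff]
  have hne : (occupied x i)ᶜ.Nonempty := ⟨x i, Finset.mem_compl.2 h1⟩
  by_contra hcon
  have h3 := h2 (parkChoice comp q (ω i) (occupied x i)ᶜ (g i))
    (Finset.mem_compl.1 (parkChoice_mem hne))
  refine h3.not_gt ?_
  rw [graphDist_pathGraph hw, graphDist_pathGraph hw]
  exact implementingPrice_lt (parkChoice_mono hc hq _ _)
    (fun _ => parkChoice_self (parkChoice_mem hne)) hw
    (parkChoice_self (Finset.mem_compl.2 h1)) hcon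

theorem integral_harmonicScheme {comp q : Fin m → ℕ} {N : ℕ} [NeZero N]
    (f : (Fin n → Fin N) → ℝ) :
    ∫ ω, f ω ∂(harmonicScheme n w comp q N).μ = ((N : ℝ) ^ n)⁻¹ * ∑ ω, f ω := by
  change ∫ ω, f ω ∂(PMF.uniformOfFintype (Fin n → Fin N)).toMeasure = _
  rw [PMF.integral_eq_sum, Finset.mul_sum]
  refine Finset.sum_congr rfl fun ω _ => ?_
  simp [PMF.uniformOfFintype_apply]

theorem forall_of_ae_harmonicScheme {comp q : Fin m → ℕ} {N : ℕ} [NeZero N]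
    {p : (Fin n → Fin N) → Prop} (h : ∀ᵐ ω ∂(harmonicScheme n w comp q N).μ, p ω) (ω) : p ω := by
  change ∀ᵐ ω ∂(PMF.uniformOfFintype (Fin n → Fin N)).toMeasure, p ω at h
  rw [ae_iff_of_countable] at h
  refine h ω ?_
  rw [PMF.toMeasure_apply_singleton _ _ (measurableSet_singleton ω)]
  simp [PMF.uniformOfFintype_apply]

theorem exists_scheme_le (hnm : n ≤ m) (hw : ∀ e ∈ (SimpleGraph.pathGraph m).edgeSet, 0 < w e)
    {ε Λ : ℝ} (hε : 0 < ε) (hΛ : 0 ≤ Λ) :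
    ∃ P : PricingScheme n (Fin m), ∀ g : Fin n → Fin m,
      optCost (graphDist (SimpleGraph.pathGraph m) w) g ≤ Λ →
      ∀ x : P.Ω → Fin n → Fin m,
        (∀ᵐ ω ∂P.μ, x ω ∈ P.equilibria (graphDist (SimpleGraph.pathGraph m) w) g ω) →
        ∫ ω, socialCost (graphDist (SimpleGraph.pathGraph m) w) g (x ω) ∂P.μ ≤
          (3 * (1 + 2 * Real.log ((n + 1) * Λ / ε + 1)) + 2) *
            (optCost (graphDist (SimpleGraph.pathGraph m) w) g + n * ε) + n * ε := by
  have hc := lineComponent_mono (w := w) Λ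
  have hq := roundedPos_mono hw hε
  have hgap := gapBound_line hw hε hΛ n
  set comp := lineComponent w Λ
  set q := roundedPos w ε
  set Δ := (n + 1) * Λ / ε + 1 with hΔdef
  have hΔ : 1 ≤ Δ := le_add_of_nonneg_left (by positivity)
  have hK : 0 ≤ 3 * (1 + 2 * Real.log Δ) + 2 := by linarith [Real.log_nonneg hΔ]
  -- A common multiple of all possible gaps, so that a uniform element of `Fin N` is uniform modulo
  -- each of them.
  have hN : ∀ l r, q l < q r → q r - q l ∣ (∑ v, q v).factorial := fun l r hlr =>
    Nat.dvd_factorial (Nat.sub_pos_of_lt hlr) ((Nat.sub_le _ _).trans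
      (Finset.single_le_sum (fun _ _ => Nat.zero_le _) (Finset.mem_univ r)))
  have hN0 := Nat.factorial_pos (∑ v, q v)
  generalize (∑ v, q v).factorial = N at hN hN0
  have : NeZero N := ⟨hN0.ne'⟩
  refine ⟨harmonicScheme n w comp q N, fun g hg x hx => ?_⟩
  change (Fin n → Fin N) → Fin n → Fin m at x
  have hx' := forall_of_ae_harmonicScheme hx
  obtain ⟨o, ho⟩ := exists_socialCost_eq_optCost hnm (graphDist (SimpleGraph.pathGraph m) w) g
  have hoc : ∀ i, comp (o i) = comp (g i) := by
    intro i
    refine (lineComponent_eq_of_dist_le hw (le_trans ?_ hg)).symm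
    rw [← ho]
    exact Finset.single_le_sum (f := fun i => graphDist (SimpleGraph.pathGraph m) w (g i) (o i))
      (fun i _ => graphDist_nonneg hw _ _) (Finset.mem_univ i)
  have hfeas : ComponentwiseFeasible comp g Finset.univ := by
    intro k
    refine Finset.card_le_card_of_injOn o (fun i hi => ?_) o.injective.injOn
    simp only [Finset.coe_filter, Finset.mem_univ, true_and, Set.mem_ofPred_eq] at hi ⊢
    rw [hoc, hi]
  have hsum := sum_roundDist_parkChoice hc hq hN n g Finset.univ x hfeas
    fun ω i => eq_parkChoice_of_mem_equilibria hw hc hq (hx' ω) i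
  have hcost := harmonicCost_le hc hq hΔ hgap n g o Finset.univ o.injective
    (fun _ => Finset.mem_univ _) hoc (by simp)
  have hupper : ∀ y : Fin n → Fin m, socialCost (graphDist (SimpleGraph.pathGraph m) w) g y ≤
      ε * ∑ i, roundDist q (g i) (y i) + n * ε := by
    intro y
    have : (n : ℝ) * ε = ∑ _i : Fin n, ε := by simp
    rw [this, Finset.mul_sum, ← Finset.sum_add_distrib]
    refine Finset.sum_le_sum fun i _ => ?_
    linarith [(abs_le.1 (abs_sub_roundDist_le hw hε (g i) (y i))).2]
  have hlower : ε * ∑ i, roundDist q (g i) (o i) ≤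
      optCost (graphDist (SimpleGraph.pathGraph m) w) g + n * ε := by
    have : (n : ℝ) * ε = ∑ _i : Fin n, ε := by simp
    rw [← ho, this, Finset.mul_sum, socialCost, ← Finset.sum_add_distrib]
    refine Finset.sum_le_sum fun i _ => ?_
    linarith [(abs_le.1 (abs_sub_roundDist_le hw hε (g i) (o i))).1]
  have hNn : (0 : ℝ) < (N : ℝ) ^ n := by positivity
  refine (integral_harmonicScheme fun ω =>
    socialCost (graphDist (SimpleGraph.pathGraph m) w) g (x ω)).trans_le ?_
  calc ((N : ℝ) ^ n)⁻¹ * ∑ ω, socialCost (graphDist (SimpleGraph.pathGraph m) w) g (x ω)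
      ≤ ((N : ℝ) ^ n)⁻¹ * ∑ ω, (ε * ∑ i, roundDist q (g i) (x ω i) + n * ε) :=
        mul_le_mul_of_nonneg_left (Finset.sum_le_sum fun ω _ => hupper (x ω))
          (inv_nonneg.2 hNn.le)
    _ = ε * harmonicCost comp q n g Finset.univ + n * ε := by
        rw [Finset.sum_add_distrib, ← Finset.mul_sum, hsum]
        simp only [Finset.sum_const, Finset.card_univ, Fintype.card_fun, Fintype.card_fin,
          nsmul_eq_mul, Nat.cast_pow]
        field_simp
    _ ≤ _ := by
        have h1 := mul_le_mul_of_nonneg_left hcost hε.le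
        have h2 := mul_le_mul_of_nonneg_left hlower hK
        linarith

end Scheme

/-! ### Numerical bounds and the choice of the scales `ε` and `Λ`. -/

theorem exists_eval_le_mul_pow (p : Polynomial ℝ) :
    ∃ c : ℝ, 1 ≤ c ∧ ∀ n : ℕ, 1 ≤ n → p.eval (n : ℝ) ≤ c * (n : ℝ) ^ p.natDegree := by
  refine ⟨1 + ∑ i ∈ Finset.range (p.natDegree + 1), |p.coeff i|,
    le_add_of_nonneg_right (Finset.sum_nonneg fun _ _ => abs_nonneg _), fun n hn => ?_⟩
  have hn' : (1 : ℝ) ≤ n := by exact_mod_cast hn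
  rw [Polynomial.eval_eq_sum_range, add_mul, Finset.sum_mul]
  refine le_trans (Finset.sum_le_sum fun i hi => ?_) (le_add_of_nonneg_left (by positivity))
  exact (mul_le_mul_of_nonneg_right (le_abs_self _) (by positivity)).trans
    (mul_le_mul_of_nonneg_left (pow_le_pow_right₀ hn' (Nat.lt_succ_iff.1 (Finset.mem_range.1 hi)))
      (abs_nonneg _))

theorem exists_log_bound (p : Polynomial ℝ) (hp : ∀ n : ℕ, 1 ≤ n → 0 < p.eval (n : ℝ)) :
    ∃ C : ℝ, ∀ n : ℕ, 2 ≤ n →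
      11 + 12 * Real.log ((n + 1) * (p.eval (n : ℝ) ^ 2 * n) + 1) ≤ C * Real.log n := by
  obtain ⟨c, hc, hcp⟩ := exists_eval_le_mul_pow p
  have hlog2 : 0 < Real.log 2 := Real.log_pos one_lt_two
  refine ⟨(11 + 12 * Real.log (3 * c ^ 2)) / Real.log 2 + 12 * (2 * p.natDegree + 2 : ℕ),
    fun n hn => ?_⟩
  have hn' : (2 : ℝ) ≤ n := by exact_mod_cast hn
  have hpos := hp n (by omega)
  have hle := hcp n (by omega)
  have hsq : p.eval (n : ℝ) ^ 2 ≤ c ^ 2 * (n : ℝ) ^ (2 * p.natDegree) := by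
    calc p.eval (n : ℝ) ^ 2 ≤ (c * (n : ℝ) ^ p.natDegree) ^ 2 := by gcongr
      _ = _ := by ring
  have hone : (1 : ℝ) ≤ c ^ 2 * (n : ℝ) ^ (2 * p.natDegree) :=
    one_le_mul_of_one_le_of_one_le (one_le_pow₀ hc) (one_le_pow₀ (by linarith))
  have harg : (n + 1 : ℝ) * (p.eval (n : ℝ) ^ 2 * n) + 1 ≤
      3 * c ^ 2 * (n : ℝ) ^ (2 * p.natDegree + 2) := by
    have h1 : (n + 1 : ℝ) * (p.eval (n : ℝ) ^ 2 * n) ≤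
        (n + 1) * ((c ^ 2 * (n : ℝ) ^ (2 * p.natDegree)) * n) := by gcongr
    have h2 : 3 * c ^ 2 * (n : ℝ) ^ (2 * p.natDegree + 2) =
        3 * (c ^ 2 * (n : ℝ) ^ (2 * p.natDegree)) * n ^ 2 := by ring
    rw [h2]
    generalize c ^ 2 * (n : ℝ) ^ (2 * p.natDegree) = y at *
    nlinarith [mul_nonneg (sub_nonneg.2 hone) (sq_nonneg (n : ℝ)),
      mul_nonneg (by linarith : (0 : ℝ) ≤ y) (by nlinarith : (0 : ℝ) ≤ n ^ 2 - n)]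
  have h3 : Real.log ((n + 1) * (p.eval (n : ℝ) ^ 2 * n) + 1) ≤
      Real.log (3 * c ^ 2) + (2 * p.natDegree + 2 : ℕ) * Real.log n := by
    rw [← Real.log_pow, ← Real.log_mul (by positivity) (by positivity)]
    exact Real.log_le_log (by positivity) harg
  have h4 : Real.log 2 ≤ Real.log n := Real.log_le_log two_pos hn'
  have h5 : 0 ≤ Real.log (3 * c ^ 2) := Real.log_nonneg (by nlinarith)
  have h6 : 11 + 12 * Real.log (3 * c ^ 2) ≤
      (11 + 12 * Real.log (3 * c ^ 2)) / Real.log 2 * Real.log n := by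
    rw [div_mul_eq_mul_div, le_div_iff₀ hlog2]
    exact mul_le_mul_of_nonneg_left h4 (by linarith)
  linarith

theorem mainTheorem4 (p : Polynomial ℝ) (hp : ∀ n : ℕ, 1 ≤ n → 0 < p.eval (n : ℝ)) :
    ∃ C : ℝ, ∀ (n m : ℕ), n ≤ m →
      ∀ w : Sym2 (Fin m) → ℝ, (∀ e ∈ (SimpleGraph.pathGraph m).edgeSet, 0 < w e) →
      ∀ Z : ℝ, ∃ P : PricingScheme n (Fin m),
        ∀ g : Fin n → Fin m,
          optCost (graphDist (SimpleGraph.pathGraph m) w) g / p.eval (n : ℝ) ≤ Z →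
          Z ≤ p.eval (n : ℝ) * optCost (graphDist (SimpleGraph.pathGraph m) w) g →
          ∀ x : P.Ω → (Fin n → Fin m), Measurable x →
            (∀ᵐ ω ∂P.μ, x ω ∈ P.equilibria (graphDist (SimpleGraph.pathGraph m) w) g ω) →
            ∫ ω, socialCost (graphDist (SimpleGraph.pathGraph m) w) g (x ω) ∂P.μ ≤
              C * Real.log n * optCost (graphDist (SimpleGraph.pathGraph m) w) g := by
  obtain ⟨C, hC⟩ := exists_log_bound p hp
  refine ⟨C, fun n m hnm w hw Z => ?_⟩
  have hopt : ∀ g : Fin n → Fin m, 0 ≤ optCost (graphDist (SimpleGraph.pathGraph m) w) g :=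
    fun g => Real.iInf_nonneg fun x => Finset.sum_nonneg fun i _ => graphDist_nonneg hw _ _
  rcases lt_or_ge n 2 with hn | hn
  -- Here `log n = 0`, so the cost must vanish; without fees a single car parks at its destination.
  · refine ⟨zeroScheme n m, fun g _ _ x _ hx => ?_⟩
    have : Subsingleton (Fin n) := Fin.subsingleton_iff_le_one.2 (by omega)
    rw [integral_socialCost_zeroScheme hw (Function.injective_of_subsingleton g) hx]
    have hlog : Real.log n = 0 := by interval_cases n <;> simp
    simp [hlog]
  have hP := hp n (by omega)
  have hn' : (0 : ℝ) < n := by exact_mod_cast (show 0 < n by omega)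
  rcases le_or_gt Z 0 with hZ | hZ
  -- The lower estimate forces the optimum to be `0`, so destinations are distinct and free parking
  -- is optimal.
  · refine ⟨zeroScheme n m, fun g hg _ x _ hx => ?_⟩
    rw [div_le_iff₀ hP] at hg
    have h0 : optCost (graphDist (SimpleGraph.pathGraph m) w) g ≤ 0 := by nlinarith
    rw [integral_socialCost_zeroScheme hw (injective_of_optCost_nonpos hnm hw h0) hx,
      le_antisymm h0 (hopt g), mul_zero]
  -- The estimates give `OPT ≤ Λ` and `nε = Z / p(n) ≤ OPT`. With `L` the logarithm in the bound,
  -- the cost is at most `(3 (1 + 2L) + 2) · 2 OPT + OPT = (11 + 12L) OPT`, and `Z` cancels in `Λ /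
  -- ε`.
  · obtain ⟨P, hPr⟩ := exists_scheme_le (n := n) hnm hw
      (ε := Z / (p.eval (n : ℝ) * n)) (Λ := p.eval (n : ℝ) * Z) (by positivity) (by positivity)
    refine ⟨P, fun g hg1 hg2 x _ hx => ?_⟩
    rw [div_le_iff₀ hP] at hg1
    have h1 := hPr g (by linarith) x hx
    have h2 : (n : ℝ) * (Z / (p.eval (n : ℝ) * n)) ≤
        optCost (graphDist (SimpleGraph.pathGraph m) w) g := by
      rw [show (n : ℝ) * (Z / (p.eval (n : ℝ) * n)) = Z / p.eval (n : ℝ) by field_simp,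
        div_le_iff₀ hP]
      linarith
    have h3 : (n + 1 : ℝ) * (p.eval (n : ℝ) * Z) / (Z / (p.eval (n : ℝ) * n)) =
        (n + 1) * (p.eval (n : ℝ) ^ 2 * n) := by field_simp
    rw [h3] at h1
    have h4 := hC n hn
    have h5 : 0 ≤ Real.log ((n + 1) * (p.eval (n : ℝ) ^ 2 * n) + 1) :=
      Real.log_nonneg (le_add_of_nonneg_left (by positivity))
    refine h1.trans (le_trans ?_ (mul_le_mul_of_nonneg_right h4 (hopt g)))
    have h6 := mul_le_mul_of_nonneg_left h2
      (show 0 ≤ 3 * (1 + 2 * Real.log ((n + 1) * (p.eval (n : ℝ) ^ 2 * n) + 1)) + 2 by linarith)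
    linarith
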